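/- Let $0\le\alpha<1$. Let $\rho\in C^\infty(\mathbb{R})$ be a non-negative function with $\rho(\xi)=0$ for $\xi\le -1$, $\rho(\xi)=1$ for $\xi\ge 1$, and $\rho(\xi)^2+\rho(-\xi)^2=1$ for all $\xi\in\mathbb{R}$. For an interval $I=[a,a')$ with cutoff radii $\varepsilon,\varepsilon'>0$ at $a$ and $a'$, and for $n\in\mathbb{N}_0$, the brushlet $w_{n,I}$ is the function on $\mathbb{R}$ with Fourier transform $$\hat w_{n,I}(\xi)=\sqrt{\tfrac{2}{|I|}}\;\rho\Bigl(\frac{\xi-a}{\varepsilon}\Bigr)\rho\Bigl(\frac{a'-\xi}{\varepsilon'}\Bigr)\cos\Bigl(\pi\bigl(n+\tfrac12\bigr)\frac{\xi-a}{|I|}\Bigr),$$ where $\hat f(\xi)=(2\pi)^{-1/2}\int_{\mathbb{R}} f(x)e^{-ix\xi}\,dx$. Put $R_j=j^{1/(1-\alpha)}$ for integers $j\ge 1$ and $R_j=|j|^{-1/(1-\alpha)}$ for integers $j\le -1$, and $A_j=[-R_j,R_j)$; thus $A_{-1}=A_1$. For each integer $j\notin\{0,1\}$, let $N_j\ge 1$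 be an integer and divide $A_j$ into $2N_j+1$ intervals $I_{j,n}=[r_{j,n},r_{j,n+1})$, $-N_j\le n\le N_j$, with $r_{j,-N_j}<\dots<r_{j,N_j+1}$, such that $$I_{j,-N_j}=[-R_j,-R_{j-1}),\qquad I_{j,N_j}=[R_{j-1},R_j).$$ To every endpoint $t$ of one of these intervals assign a cutoff radius $\varepsilon(t)>0$, such that $\varepsilon(r_{j,n})+\varepsilon(r_{j,n+1})\le|I_{j,n}|$ for all $j$ and $n$, and let the interval $I_{j,n}$ have the cutoff radii $\varepsilon(r_{j,n})$ and $\varepsilon(r_{j,n+1})$ at its left and right endpoint. For $j\notin\{0,1\}$ let $\mathcal{A}_j$ be the set of the rectangles $I_{j,m}\times I_{j,n}$ with $-N_j\le m,n\le N_j$ and $\max(|m|,|n|)=N_j$, and put $\mathcal{A}_0=\mathcal{A}_1=\emptyset$. For $Q=I\times J\in\mathcal{A}_j$ and $n=(n_1,n_2)\in\mathbb{N}_0^2$ put $w_{n,Q}=w_{n_1,I}\otimes w_{n_2,J}$. Then the system $\{w_{n,Q}: n\in\mathbb{N}_0^2,\ Q\in\mathcal{A}_j,\ j\in\mathbb{Z}\}$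 is an orthonormal basis of $L_2(\mathbb{R}^2)$. -/

import Mathlib

open MeasureTheory
open scoped ContDiff

noncomputable section

namespace Brushlet

/-- A non-negative smooth ramp function. -/
structure IsRamp (ρ : ℝ → ℝ) : Prop where
  smooth : ContDiff ℝ ∞ ρ
  nonneg : ∀ ξ, 0 ≤ ρ ξ
  eq_zero : ∀ ξ, ξ ≤ -1 → ρ ξ = 0
  eq_one : ∀ ξ, 1 ≤ ξ → ρ ξ = 1
  sq_add_sq : ∀ ξ, ρ ξ ^ 2 + ρ (-ξ) ^ 2 = 1

/-- The bell function of the interval `[a, b)` with cutoff radii `ε` at `a` and `ε'` at `b`. -/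
def bell (ρ : ℝ → ℝ) (a b ε ε' : ℝ) (ξ : ℝ) : ℝ :=
  ρ ((ξ - a) / ε) * ρ ((b - ξ) / ε')

/-- The local cosine function of `[a, b)`, which is the Fourier transform of the brushlet. -/
def brushletHat (ρ : ℝ → ℝ) (a b ε ε' : ℝ) (n : ℕ) (ξ : ℝ) : ℝ :=
  √(2 / (b - a)) * bell ρ a b ε ε' ξ *
    Real.cos (Real.pi * ((n : ℝ) + 1 / 2) * ((ξ - a) / (b - a)))

/-- The univariate brushlet: the inverse Fourier transform of `brushletHat`, for the unitary
normalization `f̂(ξ) = (2π)^{-1/2} ∫ f(x) e^{-ixξ} dx`. -/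
def brushlet (ρ : ℝ → ℝ) (a b ε ε' : ℝ) (n : ℕ) (x : ℝ) : ℂ :=
  ((√(2 * Real.pi))⁻¹ : ℝ) *
    ∫ ξ : ℝ, Complex.exp (Complex.I * x * ξ) * (brushletHat ρ a b ε ε' n ξ : ℂ)

/-- The positive endpoint of the interval `A_j`: it is `j^{1/(1-α)}` for `j ≥ 1` and
`|j|^{-1/(1-α)}` for `j ≤ -1`. -/
def radius (α : ℝ) (j : ℤ) : ℝ :=
  if 0 < j then (j : ℝ) ^ (1 / (1 - α)) else |(j : ℝ)| ^ (-(1 / (1 - α)))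

/-- The levels `j` that carry a non-empty annulus. The annulus of level `j` fills the region between
the squares `A_{j-1} × A_{j-1}` and `A_j × A_j`. There is none at level `0`, and none at level `1`
because the annuli of the negative levels already fill `A_{-1} × A_{-1} = A_1 × A_1`. -/
def IsLevel (j : ℤ) : Prop := j ≤ -1 ∨ 2 ≤ j

/-- The data of a separable rectangular `α`-covering with compatible endpoints and cutoff radii.
At each level `j` the interval `A_j` is divided into the `2 N_j + 1` intervals
`I_{j,n} = [r_{j,n}, r_{j,n+1})`, `-N_j ≤ n ≤ N_j`, the two outermost of which are the two
components of `A_j \ A_{j-1}`. The cutoff radius at an endpoint `t` is `ε t`; hence intervals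
that share an endpoint have the same cutoff radius there. -/
structure AlphaCovering (α : ℝ) where
  N : ℤ → ℕ
  r : ℤ → ℤ → ℝ
  ε : ℝ → ℝ
  one_le_N : ∀ j, IsLevel j → 1 ≤ N j
  r_lt : ∀ j, IsLevel j → ∀ n ∈ Set.Icc (-(N j : ℤ)) (N j), r j n < r j (n + 1)
  r_first : ∀ j, IsLevel j → r j (-(N j : ℤ)) = -radius α j
  r_second : ∀ j, IsLevel j → r j (-(N j : ℤ) + 1) = -radius α (j - 1)
  r_penultimate : ∀ j, IsLevel j → r j (N j) = radius α (j - 1)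
  r_last : ∀ j, IsLevel j → r j ((N j : ℤ) + 1) = radius α j
  ε_pos : ∀ j, IsLevel j → ∀ n ∈ Set.Icc (-(N j : ℤ)) ((N j : ℤ) + 1), 0 < ε (r j n)
  ε_add_le : ∀ j, IsLevel j → ∀ n ∈ Set.Icc (-(N j : ℤ)) (N j),
    ε (r j n) + ε (r j (n + 1)) ≤ r j (n + 1) - r j n

namespace AlphaCovering

variable {α : ℝ} (C : AlphaCovering α)

/-- Left side of the annulus; a pair `(m, n)` stands for the rectangle `I_{j,m} × I_{j,n}`. -/
def annulusL (j : ℤ) : Set (ℤ × ℤ) :=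
  {q | q.1 = -(C.N j : ℤ) ∧ -(C.N j : ℤ) ≤ q.2 ∧ q.2 ≤ C.N j}

/-- Right side of the annulus. -/
def annulusR (j : ℤ) : Set (ℤ × ℤ) :=
  {q | q.1 = (C.N j : ℤ) ∧ -(C.N j : ℤ) ≤ q.2 ∧ q.2 ≤ C.N j}

/-- Top of the annulus. -/
def annulusT (j : ℤ) : Set (ℤ × ℤ) :=
  {q | q.2 = (C.N j : ℤ) ∧ -(C.N j : ℤ) < q.1 ∧ q.1 < C.N j}

/-- Bottom of the annulus. -/
def annulusB (j : ℤ) : Set (ℤ × ℤ) :=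
  {q | q.2 = -(C.N j : ℤ) ∧ -(C.N j : ℤ) < q.1 ∧ q.1 < C.N j}

/-- The rectangular annulus `𝒜_j`, empty if `j` is not a level. -/
def annulus (j : ℤ) : Set (ℤ × ℤ) :=
  {q | IsLevel j ∧ q ∈ C.annulusL j ∪ C.annulusR j ∪ C.annulusT j ∪ C.annulusB j}

/-- The univariate brushlet `w_{k,I}` of the interval `I = I_{j,n}`. -/
def univariate (ρ : ℝ → ℝ) (j n : ℤ) (k : ℕ) : ℝ → ℂ :=
  brushlet ρ (C.r j n) (C.r j (n + 1)) (C.ε (C.r j n)) (C.ε (C.r j (n + 1))) k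

/-- The bivariate brushlet `w_{k,Q} = w_{k₁,I} ⊗ w_{k₂,J}` of the rectangle
`Q = I × J = I_{j,q₁} × I_{j,q₂}`. -/
def bivariate (ρ : ℝ → ℝ) (j : ℤ) (q : ℤ × ℤ) (k : ℕ × ℕ) (x : ℝ × ℝ) : ℂ :=
  C.univariate ρ j q.1 k.1 x.1 * C.univariate ρ j q.2 k.2 x.2

end AlphaCovering

end Brushlet

end

/-!
Smooth cutoffs with `ρ(ξ)² + ρ(-ξ)² = 1` define orthogonal projections of `L²(ℝ)` onto spaces
`E(t)` of functions that live smoothly on the half line to the right of `t`: the products of the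
cutoff with functions that are even about `t`. These spaces decrease along admissible endpoints,
and, by folding at both endpoints, the local cosine functions of `[a, b)` are an orthonormal basis
of the orthogonal difference `E(a) ⊖ E(b)`. Hence the functions of one annulus span exactly the
difference of the tensor squares of `E(-R_j) ⊖ E(R_j)` and `E(-R_{j-1}) ⊖ E(R_{j-1})`. If `h` is
orthogonal to the whole system and `P_j` is the projection onto `E(-R_j) ⊖ E(R_j)`, then
`⟪h, P_j f ⊗ P_j g⟫` does not depend on `j`; it tends to `⟪h, f ⊗ g⟫` as `j → ∞` and to `0` as
`j → -∞`, so `h = 0`.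
-/

noncomputable section

namespace Brushlet

open Filter Topology
open scoped InnerProductSpace

section OrthoDiff

variable {𝕜 H : Type*} [RCLike 𝕜] [NormedAddCommGroup H] [InnerProductSpace 𝕜 H]

/-- The relative orthogonal complement `U ⊖ V` of `V` in `U`; no inclusion is required. -/
def orthoDiff (U V : Submodule 𝕜 H) : Submodule 𝕜 H := U ⊓ Vᗮ

lemma mem_orthoDiff {U V : Submodule 𝕜 H} {f : H} : f ∈ orthoDiff U V ↔ f ∈ U ∧ f ∈ Vᗮ :=
  Submodule.mem_inf

lemma orthoDiff_mono {U V U' V' : Submodule 𝕜 H} (hU : U ≤ U') (hV : V' ≤ V) :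
    orthoDiff U V ≤ orthoDiff U' V' :=
  inf_le_inf hU (Submodule.orthogonal_le hV)

lemma isOrtho_orthoDiff {U V U' V' : Submodule 𝕜 H} (h : U' ≤ V) :
    orthoDiff U V ⟂ orthoDiff U' V' :=
  (Submodule.isOrtho_orthogonal_left V).mono inf_le_right (inf_le_left.trans h)

variable [CompleteSpace H]

instance (U V : Submodule 𝕜 H) [CompleteSpace U] : CompleteSpace (orthoDiff U V) :=
  have hU : IsClosed (U : Set H) :=
    (completeSpace_coe_iff_isComplete.1 ‹CompleteSpace U›).isClosed
  (hU.inter (Submodule.isClosed_orthogonal V)).completeSpace_coe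

lemma starProjection_orthoDiff {U V : Submodule 𝕜 H} [CompleteSpace U] [CompleteSpace V]
    (h : V ≤ U) (f : H) :
    (orthoDiff U V).starProjection f = U.starProjection f - V.starProjection f := by
  have hV : U.starProjection f - V.starProjection f ∈ Vᗮ := by
    rw [← sub_sub_sub_cancel_left _ _ f]
    exact Vᗮ.sub_mem (V.sub_starProjection_mem_orthogonal f)
      (Submodule.orthogonal_le h (U.sub_starProjection_mem_orthogonal f))
  have hU : U.starProjection f - V.starProjection f ∈ U :=
    U.sub_mem (U.starProjection_apply_mem f) (h (V.starProjection_apply_mem f))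
  refine Submodule.eq_starProjection_of_mem_orthogonal (mem_orthoDiff.2 ⟨hU, hV⟩) ?_
  intro w hw
  rw [sub_sub_eq_add_sub, add_sub_right_comm, inner_add_right,
    U.sub_starProjection_mem_orthogonal f w hw.1,
    Submodule.inner_left_of_mem_orthogonal (V.starProjection_apply_mem f) hw.2, add_zero]

lemma orthogonal_orthoDiff_le {U V : Submodule 𝕜 H} [CompleteSpace U] [CompleteSpace V]
    (h : V ≤ U) : (orthoDiff U V)ᗮ ≤ Uᗮ ⊔ V := by
  intro f hf
  have hproj : U.starProjection f - V.starProjection f = 0 := by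
    rw [← starProjection_orthoDiff h, Submodule.starProjection_apply_eq_zero_iff]
    exact hf
  refine Submodule.mem_sup.2 ⟨f - U.starProjection f, U.sub_starProjection_mem_orthogonal f,
    V.starProjection f, V.starProjection_apply_mem f, ?_⟩
  rw [← sub_eq_zero.1 hproj, sub_add_cancel]

lemma sum_starProjection_orthoDiff {U : ℤ → Submodule 𝕜 H} [∀ i, CompleteSpace (U i)] {m n : ℤ}
    (hmn : m ≤ n) (hU : ∀ i ∈ Finset.Ico m n, U (i + 1) ≤ U i) (f : H) :
    ∑ i ∈ Finset.Ico m n, (orthoDiff (U i) (U (i + 1))).starProjection f =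
      (U m).starProjection f - (U n).starProjection f := by
  rw [Finset.sum_congr rfl fun i hi => starProjection_orthoDiff (hU i hi) f]
  clear hU
  induction n, hmn using Int.leInduction with
  | base => simp
  | succ n hmn ih =>
    rw [← Finset.insert_Ico_right_eq_Ico_add_one hmn, Finset.sum_insert (by simp), ih]
    abel

lemma tendsto_starProjection_atTop {ι : Type*} [Preorder ι] {U : ι → Submodule 𝕜 H}
    [∀ i, (U i).HasOrthogonalProjection] (hU : Monotone U) (h : ⨅ i, (U i)ᗮ = ⊥) (f : H) :
    Tendsto (fun i => (U i).starProjection f) atTop (𝓝 f) := by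
  refine Submodule.starProjection_tendsto_self U hU f (top_le_iff.2 ?_)
  rw [Submodule.topologicalClosure_eq_top_iff, ← Submodule.iInf_orthogonal, h]

lemma tendsto_starProjection_atBot {ι : Type*} [Preorder ι] {U : ι → Submodule 𝕜 H}
    [∀ i, (U i).HasOrthogonalProjection] (hU : Monotone U) (h : ⨅ i, U i = ⊥) (f : H) :
    Tendsto (fun i => (U i).starProjection f) atBot (𝓝 0) := by
  have hcompl : Tendsto (fun i => (U i)ᗮ.starProjection f) atBot (𝓝 f) :=
    tendsto_starProjection_atTop (U := fun i : ιᵒᵈ => (U (OrderDual.ofDual i))ᗮ)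
      (fun _ _ hij => Submodule.orthogonal_le (hU hij))
      (by simp only [Submodule.orthogonal_orthogonal]; exact h) f
  simpa [Submodule.starProjection_orthogonal_val] using (tendsto_const_nhds (x := f)).sub hcompl

end OrthoDiff

section HilbertTensor

variable {𝕜 H₁ H₂ K : Type*} [RCLike 𝕜] [NormedAddCommGroup H₁] [InnerProductSpace 𝕜 H₁]
  [NormedAddCommGroup H₂] [InnerProductSpace 𝕜 H₂] [NormedAddCommGroup K] [InnerProductSpace 𝕜 K]

/-- The bilinear map `T` exhibits `K` as the Hilbert space tensor product of `H₁` and `H₂`. -/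
structure IsHilbertTensor (T : H₁ →L[𝕜] H₂ →L[𝕜] K) : Prop where
  inner_apply : ∀ x y x' y', ⟪T x y, T x' y'⟫_𝕜 = ⟪x, x'⟫_𝕜 * ⟪y, y'⟫_𝕜
  eq_zero : ∀ h, (∀ x y, ⟪T x y, h⟫_𝕜 = 0) → h = 0

lemma IsHilbertTensor.bilinearComp_linearIsometryEquiv {T : H₁ →L[𝕜] H₂ →L[𝕜] K}
    (hT : IsHilbertTensor T) {G₁ G₂ : Type*} [NormedAddCommGroup G₁] [InnerProductSpace 𝕜 G₁]
    [NormedAddCommGroup G₂] [InnerProductSpace 𝕜 G₂] (e₁ : G₁ ≃ₗᵢ[𝕜] H₁) (e₂ : G₂ ≃ₗᵢ[𝕜] H₂) :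
    IsHilbertTensor (T.bilinearComp (e₁ : G₁ →L[𝕜] H₁) (e₂ : G₂ →L[𝕜] H₂)) where
  inner_apply x y x' y' := by simp [hT.inner_apply]
  eq_zero h hh := hT.eq_zero h fun x y => by simpa using hh (e₁.symm x) (e₂.symm y)

lemma IsHilbertTensor.orthonormal {T : H₁ →L[𝕜] H₂ →L[𝕜] K} (hT : IsHilbertTensor T) {ι : Type*}
    {x : ι → H₁} {y : ι → H₂} (hx : ∀ i, ‖x i‖ = 1) (hy : ∀ i, ‖y i‖ = 1)
    (hxy : ∀ i j, i ≠ j → ⟪x i, x j⟫_𝕜 = 0 ∨ ⟪y i, y j⟫_𝕜 = 0) :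
    Orthonormal 𝕜 fun i => T (x i) (y i) := by
  refine ⟨fun i => ?_, fun i j hij => ?_⟩
  · have hsq : ‖T (x i) (y i)‖ ^ 2 = 1 := by
      rw [@norm_sq_eq_re_inner 𝕜, hT.inner_apply, inner_self_eq_norm_sq_to_K,
        inner_self_eq_norm_sq_to_K, hx, hy]
      simp
    exact (pow_eq_one_iff_of_nonneg (norm_nonneg _) two_ne_zero).1 hsq
  · simpa only [hT.inner_apply, mul_eq_zero] using hxy i j hij

variable (T : H₁ →L[𝕜] H₂ →L[𝕜] K)

lemma inner_apply_eq_zero_of_hilbertBasis {U₁ : Submodule 𝕜 H₁} {U₂ : Submodule 𝕜 H₂}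
    {ι₁ ι₂ : Type*} (b₁ : HilbertBasis ι₁ 𝕜 U₁) (b₂ : HilbertBasis ι₂ 𝕜 U₂) {h : K}
    (hb : ∀ k l, ⟪h, T (b₁ k) (b₂ l)⟫_𝕜 = 0) {x : H₁} (hx : x ∈ U₁) {y : H₂} (hy : y ∈ U₂) :
    ⟪h, T x y⟫_𝕜 = 0 := by
  have hbasis (l : ι₂) : (innerSL 𝕜 h ∘L T.flip (b₂ l)) ∘L U₁.subtypeL = 0 :=
    ContinuousLinearMap.ext_on
      (Submodule.dense_iff_topologicalClosure_eq_top.2 b₁.dense_span)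
      (by rintro _ ⟨k, rfl⟩; simpa using hb k l)
  have hfull : (innerSL 𝕜 h ∘L T x) ∘L U₂.subtypeL = 0 :=
    ContinuousLinearMap.ext_on
      (Submodule.dense_iff_topologicalClosure_eq_top.2 b₂.dense_span)
      (by rintro _ ⟨l, rfl⟩; simpa using DFunLike.congr_fun (hbasis l) ⟨x, hx⟩)
  simpa using DFunLike.congr_fun hfull ⟨y, hy⟩

lemma inner_apply_sum_sum_of_subset {ι : Type*} {s s' : Finset ι} (hs : s' ⊆ s) {h : K}
    {x : ι → H₁} {y : ι → H₂}
    (hxy : ∀ p ∈ s ×ˢ s, p ∉ s' ×ˢ s' → ⟪h, T (x p.1) (y p.2)⟫_𝕜 = 0) :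
    ⟪h, T (∑ i ∈ s, x i) (∑ i ∈ s, y i)⟫_𝕜 = ⟪h, T (∑ i ∈ s', x i) (∑ i ∈ s', y i)⟫_𝕜 := by
  simp only [map_sum, sum_apply, inner_sum]
  rw [Finset.sum_comm, Finset.sum_comm (s := s'), ← Finset.sum_product', ← Finset.sum_product']
  exact (Finset.sum_subset (Finset.product_subset_product hs hs) hxy).symm

end HilbertTensor

section TensorLp

variable {𝕜 X Y : Type*} [RCLike 𝕜] [MeasurableSpace X] [MeasurableSpace Y] {μ : Measure X}
  {ν : Measure Y}

lemma ae_eq_zero_of_forall_setIntegral_prod_eq_zero {E : Type*} [NormedAddCommGroup E]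
    [NormedSpace ℝ E] [CompleteSpace E] {κ : Measure (X × Y)} {f : X × Y → E}
    (hf : Integrable f κ)
    (h : ∀ s t, MeasurableSet s → MeasurableSet t → ∫ z in s ×ˢ t, f z ∂κ = 0) : f =ᵐ[κ] 0 := by
  refine hf.ae_eq_of_withDensityᵥ_eq (integrable_zero _ _ _) ?_
  refine VectorMeasure.ext_of_generateFrom _ ?_ generateFrom_prod.symm isPiSystem_prod ?_
  · rintro _ ⟨s, hs, t, ht, rfl⟩
    simpa [withDensityᵥ_apply hf (hs.prod ht)] using h s t hs ht
  · simpa [withDensityᵥ_apply hf .univ] using h .univ .univ .univ .univ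

lemma memLp_two_tensor {f : X → 𝕜} {g : Y → 𝕜} (hf : MemLp f 2 μ) (hg : MemLp g 2 ν) :
    MemLp (fun z : X × Y => f z.1 * g z.2) 2 (μ.prod ν) := by
  have hmeas : AEStronglyMeasurable (fun z : X × Y => f z.1 * g z.2) (μ.prod ν) :=
    hf.1.comp_fst.mul hg.1.comp_snd
  rw [memLp_two_iff_integrable_sq_norm hmeas]
  simpa only [norm_mul, mul_pow] using ((memLp_two_iff_integrable_sq_norm hf.1).1 hf).mul_prod
    ((memLp_two_iff_integrable_sq_norm hg.1).1 hg)

/-- The tensor product `(f ⊗ g) (x, y) = f x * g y` of two square integrable functions. -/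
def tensorLp (f : Lp 𝕜 2 μ) (g : Lp 𝕜 2 ν) : Lp 𝕜 2 (μ.prod ν) :=
  (memLp_two_tensor (Lp.memLp f) (Lp.memLp g)).toLp _

lemma coeFn_tensorLp (f : Lp 𝕜 2 μ) (g : Lp 𝕜 2 ν) :
    tensorLp f g =ᵐ[μ.prod ν] fun z => f z.1 * g z.2 :=
  MemLp.coeFn_toLp _

lemma tensorLp_congr {f : Lp 𝕜 2 μ} {g : Lp 𝕜 2 ν} {f' : X → 𝕜} {g' : Y → 𝕜} (hf : f =ᵐ[μ] f')
    (hg : g =ᵐ[ν] g') : tensorLp f g =ᵐ[μ.prod ν] fun z => f' z.1 * g' z.2 := by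
  filter_upwards [coeFn_tensorLp f g, Measure.quasiMeasurePreserving_fst.ae hf,
    Measure.quasiMeasurePreserving_snd.ae hg] with z hz hf hg
  rw [hz, hf, hg]

lemma inner_tensorLp_indicatorConstLp (h : Lp 𝕜 2 (μ.prod ν)) {s : Set X} {t : Set Y}
    (hs : MeasurableSet s) (ht : MeasurableSet t) (hμs : μ s ≠ ⊤) (hνt : ν t ≠ ⊤) :
    ⟪tensorLp (indicatorConstLp 2 hs hμs (1 : 𝕜)) (indicatorConstLp 2 ht hνt 1), h⟫_𝕜 =
      ∫ z in s ×ˢ t, h z ∂μ.prod ν := by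
  rw [L2.inner_def, ← integral_indicator (hs.prod ht)]
  refine integral_congr_ae ?_
  filter_upwards [tensorLp_congr
    (indicatorConstLp_coeFn (p := 2) (hs := hs) (hμs := hμs) (c := (1 : 𝕜)))
    (indicatorConstLp_coeFn (p := 2) (hs := ht) (hμs := hνt) (c := (1 : 𝕜)))] with z hz
  by_cases h₁ : z.1 ∈ s <;> by_cases h₂ : z.2 ∈ t <;>
    simp [hz, RCLike.inner_apply, h₁, h₂, Set.indicator]

variable [SFinite μ] [SFinite ν]

lemma inner_tensorLp (f f' : Lp 𝕜 2 μ) (g g' : Lp 𝕜 2 ν) :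
    ⟪tensorLp f g, tensorLp f' g'⟫_𝕜 = ⟪f, f'⟫_𝕜 * ⟪g, g'⟫_𝕜 := by
  rw [L2.inner_def, L2.inner_def, L2.inner_def, ← integral_prod_mul]
  refine integral_congr_ae ?_
  filter_upwards [coeFn_tensorLp f g, coeFn_tensorLp f' g'] with z hz hz'
  simp only [hz, hz', RCLike.inner_apply, map_mul]
  ring

lemma norm_tensorLp (f : Lp 𝕜 2 μ) (g : Lp 𝕜 2 ν) : ‖tensorLp f g‖ = ‖f‖ * ‖g‖ := by
  have h := inner_tensorLp f f g g
  simp only [inner_self_eq_norm_sq_to_K, ← mul_pow] at h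
  exact (sq_eq_sq₀ (norm_nonneg _) (by positivity)).1 (by exact_mod_cast h)

variable (𝕜 μ ν) in
/-- The tensor product of square integrable functions as a continuous bilinear map. -/
def tensorCLM : Lp 𝕜 2 μ →L[𝕜] Lp 𝕜 2 ν →L[𝕜] Lp 𝕜 2 (μ.prod ν) :=
  LinearMap.mkContinuous₂ (LinearMap.mk₂ 𝕜 tensorLp
    (fun f f' g => Lp.ext <| by
      filter_upwards [tensorLp_congr (Lp.coeFn_add f f') (ae_eq_refl g),
        Lp.coeFn_add (tensorLp f g) (tensorLp f' g), coeFn_tensorLp f g, coeFn_tensorLp f' g]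
        with z h h' hf hf'
      simp only [h, h', Pi.add_apply, hf, hf', add_mul])
    (fun c f g => Lp.ext <| by
      filter_upwards [tensorLp_congr (Lp.coeFn_smul c f) (ae_eq_refl g),
        Lp.coeFn_smul c (tensorLp f g), coeFn_tensorLp f g] with z h h' hf
      simp only [h, h', Pi.smul_apply, hf, smul_mul_assoc])
    (fun f g g' => Lp.ext <| by
      filter_upwards [tensorLp_congr (ae_eq_refl f) (Lp.coeFn_add g g'),
        Lp.coeFn_add (tensorLp f g) (tensorLp f g'), coeFn_tensorLp f g, coeFn_tensorLp f g']
        with z h h' hg hg'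
      simp only [h, h', Pi.add_apply, hg, hg', mul_add])
    (fun c f g => Lp.ext <| by
      filter_upwards [tensorLp_congr (ae_eq_refl f) (Lp.coeFn_smul c g),
        Lp.coeFn_smul c (tensorLp f g), coeFn_tensorLp f g] with z h h' hg
      simp only [h, h', Pi.smul_apply, hg, mul_smul_comm])) 1
    (fun f g => by rw [one_mul]; exact (norm_tensorLp f g).le)

end TensorLp

section TensorTotal

variable {𝕜 X Y : Type*} [RCLike 𝕜] [MeasurableSpace X] [MeasurableSpace Y] {μ : Measure X}
  {ν : Measure Y} [SigmaFinite μ] [SigmaFinite ν]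

lemma eq_zero_of_inner_tensorLp_eq_zero {h : Lp 𝕜 2 (μ.prod ν)}
    (hh : ∀ f g, ⟪tensorLp f g, h⟫_𝕜 = 0) : h = 0 := by
  have hbox (n : ℕ) : ∀ᵐ z ∂μ.prod ν, z ∈ spanningSets μ n ×ˢ spanningSets ν n → h z = 0 := by
    set A := spanningSets μ n
    set B := spanningSets ν n
    have hA : MeasurableSet A := measurableSet_spanningSets μ n
    have hB : MeasurableSet B := measurableSet_spanningSets ν n
    have hμA : μ A ≠ ⊤ := (measure_spanningSets_lt_top μ n).ne
    have hνB : ν B ≠ ⊤ := (measure_spanningSets_lt_top ν n).ne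
    have : IsFiniteMeasure ((μ.prod ν).restrict (A ×ˢ B)) :=
      ⟨by
        rw [Measure.restrict_apply_univ, Measure.prod_prod]
        exact (ENNReal.mul_ne_top hμA hνB).lt_top⟩
    refine (ae_restrict_iff' (hA.prod hB)).1 (ae_eq_zero_of_forall_setIntegral_prod_eq_zero
      (((Lp.memLp h).restrict _).integrable one_le_two) fun s t hs ht => ?_)
    rw [Measure.restrict_restrict (hs.prod ht), Set.prod_inter_prod,
      ← inner_tensorLp_indicatorConstLp h (hs.inter hA) (ht.inter hB)
        (measure_ne_top_of_subset Set.inter_subset_right hμA)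
        (measure_ne_top_of_subset Set.inter_subset_right hνB)]
    exact hh _ _
  rw [Lp.eq_zero_iff_ae_eq_zero]
  filter_upwards [ae_all_iff.2 hbox] with z hz
  exact hz (max (spanningSetsIndex μ z.1) (spanningSetsIndex ν z.2))
    ⟨monotone_spanningSets μ (le_max_left _ _) (mem_spanningSetsIndex μ z.1),
      monotone_spanningSets ν (le_max_right _ _) (mem_spanningSetsIndex ν z.2)⟩

variable (𝕜 μ ν) in
lemma isHilbertTensor_tensorCLM : IsHilbertTensor (tensorCLM 𝕜 μ ν) where
  inner_apply f g f' g' := inner_tensorLp f f' g g'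
  eq_zero _ h := eq_zero_of_inner_tensorLp_eq_zero h

end TensorTotal

section CutoffSpace

lemma ae_reflect (t : ℝ) {p : ℝ → Prop} (h : ∀ᵐ ξ, p ξ) : ∀ᵐ ξ, p (2 * t - ξ) :=
  (Measure.measurePreserving_sub_left volume (2 * t)).quasiMeasurePreserving.ae h

/-- The `L²` functions of the form `c` times an even function about `t`, where `c` is a cutoff
function in the sense of `IsCutoff`. The relation below encodes this without dividing by `c`. -/
def cutoffSpace (c : ℝ → ℝ) (t : ℝ) : Submodule ℂ (Lp ℂ 2 (volume : Measure ℝ)) where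
  carrier := {f | ∀ᵐ ξ, (c (2 * t - ξ) : ℂ) * f ξ = c ξ * f (2 * t - ξ)}
  zero_mem' := by
    have hzero := Lp.coeFn_zero ℂ 2 (volume : Measure ℝ)
    rw [Set.mem_ofPred_eq]
    filter_upwards [hzero, ae_reflect t hzero] with ξ h h'
    simp only [h, h', Pi.zero_apply, mul_zero]
  add_mem' := by
    intro f g hf hg
    rw [Set.mem_ofPred_eq] at hf hg ⊢
    have hadd := Lp.coeFn_add f g
    filter_upwards [hadd, ae_reflect t hadd, hf, hg] with ξ h h' hf hg
    simp only [h, h', Pi.add_apply, mul_add, hf, hg]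
  smul_mem' := by
    intro z f hf
    rw [Set.mem_ofPred_eq] at hf ⊢
    have hsmul := Lp.coeFn_smul z f
    filter_upwards [hsmul, ae_reflect t hsmul, hf] with ξ h h' hf
    simp only [h, h', Pi.smul_apply, smul_eq_mul, mul_left_comm _ z, hf]

lemma mem_cutoffSpace {c : ℝ → ℝ} {t : ℝ} {f : Lp ℂ 2 (volume : Measure ℝ)} :
    f ∈ cutoffSpace c t ↔ ∀ᵐ ξ, (c (2 * t - ξ) : ℂ) * f ξ = c ξ * f (2 * t - ξ) := Iff.rfl

lemma isClosed_cutoffSpace (c : ℝ → ℝ) (t : ℝ) :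
    IsClosed (cutoffSpace c t : Set (Lp ℂ 2 (volume : Measure ℝ))) := by
  refine IsSeqClosed.isClosed fun f g hf hg => ?_
  obtain ⟨φ, -, hφ⟩ := (tendstoInMeasure_of_tendsto_Lp hg).exists_seq_tendsto_ae
  have hf' : ∀ᵐ ξ, ∀ n, (c (2 * t - ξ) : ℂ) * f (φ n) ξ = c ξ * f (φ n) (2 * t - ξ) :=
    ae_all_iff.2 fun n => mem_cutoffSpace.1 (hf (φ n))
  refine mem_cutoffSpace.2 ?_
  filter_upwards [hf', hφ, ae_reflect t hφ] with ξ hf' hlim hlim'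
  exact tendsto_nhds_unique (hlim.const_mul _) ((hlim'.const_mul _).congr fun n => (hf' n).symm)

instance (c : ℝ → ℝ) (t : ℝ) : CompleteSpace (cutoffSpace c t) :=
  (isClosed_cutoffSpace c t).completeSpace_coe

/-- `c` is a measurable step at `t`: its square and the reflection of its square about `t` form a
partition of unity. -/
structure IsCutoff (c : ℝ → ℝ) (t : ℝ) : Prop where
  measurable : Measurable c
  sq_add_sq_reflect : ∀ ξ, c ξ ^ 2 + c (2 * t - ξ) ^ 2 = 1

namespace IsCutoff

variable {c : ℝ → ℝ} {t : ℝ} (hc : IsCutoff c t)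
include hc

lemma reflect : IsCutoff (fun ξ => c (2 * t - ξ)) t where
  measurable := hc.measurable.comp (measurable_const.sub measurable_id)
  sq_add_sq_reflect ξ := hc.sq_add_sq_reflect (2 * t - ξ)

lemma norm_le_one (ξ : ℝ) : ‖c ξ‖ ≤ 1 :=
  abs_le_one_iff_mul_self_le_one.2 (by nlinarith [hc.sq_add_sq_reflect ξ])

lemma memLp_mul {f : ℝ → ℂ} {p : ENNReal} (hf : MemLp f p volume) :
    MemLp (fun ξ => (c ξ : ℂ) * f ξ) p volume :=
  hf.of_le_mul (c := 1)
    ((Complex.measurable_ofReal.comp hc.measurable).aestronglyMeasurable.mul hf.1)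
    (.of_forall fun ξ => by
      rw [norm_mul, Complex.norm_real]
      exact mul_le_mul_of_nonneg_right (hc.norm_le_one ξ) (norm_nonneg _))

lemma sq_add_sq_reflect_complex (ξ : ℝ) : (c ξ : ℂ) ^ 2 + (c (2 * t - ξ) : ℂ) ^ 2 = 1 := by
  exact_mod_cast hc.sq_add_sq_reflect ξ

lemma inner_eq_zero {f g : Lp ℂ 2 (volume : Measure ℝ)} (hf : f ∈ cutoffSpace c t)
    (hg : ∀ᵐ ξ, (c ξ : ℂ) * g ξ = -(c (2 * t - ξ) * g (2 * t - ξ))) : ⟪f, g⟫_ℂ = 0 := by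
  have hodd : ∀ᵐ ξ, ⟪f (2 * t - ξ), g (2 * t - ξ)⟫_ℂ = -⟪f ξ, g ξ⟫_ℂ := by
    filter_upwards [mem_cutoffSpace.1 hf, hg] with ξ hf hg
    have hf' := congrArg (starRingEnd ℂ) hf
    simp only [map_mul, Complex.conj_ofReal] at hf'
    simp only [RCLike.inner_apply]
    generalize starRingEnd ℂ (f ξ) = x, starRingEnd ℂ (f (2 * t - ξ)) = x' at hf' ⊢
    linear_combination (-(g (2 * t - ξ) * x' + g ξ * x)) * hc.sq_add_sq_reflect_complex ξ +
      (c ξ * x + c (2 * t - ξ) * x') * hg + (c (2 * t - ξ) * g ξ - c ξ * g (2 * t - ξ)) * hf'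
  have hreflect : ∫ ξ, ⟪f (2 * t - ξ), g (2 * t - ξ)⟫_ℂ = ∫ ξ, ⟪f ξ, g ξ⟫_ℂ :=
    integral_sub_left_eq_self (fun ξ => ⟪f ξ, g ξ⟫_ℂ) volume (2 * t)
  rw [integral_congr_ae hodd, integral_neg] at hreflect
  rw [L2.inner_def]
  exact self_eq_neg.1 hreflect.symm

lemma exists_mem_cutoffSpace_sub (f : Lp ℂ 2 (volume : Measure ℝ)) : ∃ g ∈ cutoffSpace c t,
    ∀ᵐ ξ, (c ξ : ℂ) * (f - g) ξ = -(c (2 * t - ξ) * (f - g) (2 * t - ξ)) := by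
  have hf' : MemLp (fun ξ => f (2 * t - ξ)) 2 volume :=
    (Lp.memLp f).comp_measurePreserving (Measure.measurePreserving_sub_left volume (2 * t))
  have hmem : MemLp (fun ξ => (c ξ : ℂ) * (c ξ * f ξ + c (2 * t - ξ) * f (2 * t - ξ))) 2 volume :=
    hc.memLp_mul ((hc.memLp_mul (Lp.memLp f)).add (hc.reflect.memLp_mul hf'))
  have hg := hmem.coeFn_toLp
  have hg' := ae_reflect t hg
  refine ⟨hmem.toLp _, mem_cutoffSpace.2 ?_, ?_⟩
  · filter_upwards [hg, hg'] with ξ h h'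
    rw [h, h', sub_sub_cancel]
    ring
  · have hsub := Lp.coeFn_sub f (hmem.toLp _)
    filter_upwards [hg, hg', hsub, ae_reflect t hsub] with ξ h h' hs hs'
    rw [hs, hs', Pi.sub_apply, Pi.sub_apply, h, h', sub_sub_cancel]
    linear_combination (-(c ξ * f ξ + c (2 * t - ξ) * f (2 * t - ξ))) *
      hc.sq_add_sq_reflect_complex ξ

lemma mem_orthogonal_cutoffSpace {f : Lp ℂ 2 (volume : Measure ℝ)} :
    f ∈ (cutoffSpace c t)ᗮ ↔ ∀ᵐ ξ, (c ξ : ℂ) * f ξ = -(c (2 * t - ξ) * f (2 * t - ξ)) := by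
  refine ⟨fun hf => ?_, fun hf => (Submodule.mem_orthogonal _ _).2 fun g hg =>
    hc.inner_eq_zero hg hf⟩
  obtain ⟨g, hg, hfg⟩ := hc.exists_mem_cutoffSpace_sub f
  have hinner : ⟪g, f - g⟫_ℂ = 0 := hc.inner_eq_zero hg hfg
  rw [inner_sub_right, (Submodule.mem_orthogonal _ _).1 hf g hg, zero_sub, neg_eq_zero,
    inner_self_eq_zero] at hinner
  simpa only [hinner, sub_zero] using hfg

end IsCutoff

end CutoffSpace

section HalfLine

/-- The ramp `ρ` moved to the point `t` and rescaled to the cutoff radius `ε`. -/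
def cutoff (ρ : ℝ → ℝ) (t ε ξ : ℝ) : ℝ := ρ ((ξ - t) / ε)

/-- The `L²` functions that live smoothly on the half line `[t, ∞)`, with cutoff radius `ε`. -/
def halfLine (ρ : ℝ → ℝ) (t ε : ℝ) : Submodule ℂ (Lp ℂ 2 (volume : Measure ℝ)) :=
  cutoffSpace (cutoff ρ t ε) t

instance (ρ : ℝ → ℝ) (t ε : ℝ) : CompleteSpace (halfLine ρ t ε) :=
  inferInstanceAs (CompleteSpace (cutoffSpace _ _))

lemma cutoff_reflect (ρ : ℝ → ℝ) (t ε ξ : ℝ) : cutoff ρ t ε (2 * t - ξ) = ρ ((t - ξ) / ε) := by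
  rw [cutoff]; congr 2; ring

lemma bell_eq (ρ : ℝ → ℝ) (a b ε ε' ξ : ℝ) :
    bell ρ a b ε ε' ξ = cutoff ρ a ε ξ * cutoff ρ b ε' (2 * b - ξ) := by
  rw [bell, cutoff_reflect, cutoff]

namespace IsRamp

variable {ρ : ℝ → ℝ} (hρ : IsRamp ρ) {t ε ξ : ℝ}
include hρ

lemma continuous_cutoff (t ε : ℝ) : Continuous (cutoff ρ t ε) :=
  hρ.smooth.continuous.comp (by fun_prop)

lemma isCutoff (t ε : ℝ) : IsCutoff (cutoff ρ t ε) t where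
  measurable := (hρ.continuous_cutoff t ε).measurable
  sq_add_sq_reflect ξ := by
    have h := hρ.sq_add_sq ((ξ - t) / ε)
    rwa [← neg_div, neg_sub, ← cutoff_reflect ρ t ε] at h

lemma cutoff_eq_zero (hε : 0 < ε) (h : ξ ≤ t - ε) : cutoff ρ t ε ξ = 0 :=
  hρ.eq_zero _ (by rw [div_le_iff₀ hε]; linarith)

lemma cutoff_eq_one (hε : 0 < ε) (h : t + ε ≤ ξ) : cutoff ρ t ε ξ = 1 :=
  hρ.eq_one _ (by rw [le_div_iff₀ hε]; linarith)

lemma ae_eq_zero_of_mem_halfLine (hε : 0 < ε) {f : Lp ℂ 2 (volume : Measure ℝ)}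
    (hf : f ∈ halfLine ρ t ε) : ∀ᵐ ξ, ξ ≤ t - ε → f ξ = 0 := by
  filter_upwards [mem_cutoffSpace.1 hf] with ξ h hξ
  have hone : cutoff ρ t ε (2 * t - ξ) = 1 := hρ.cutoff_eq_one hε (by linarith)
  simpa [hρ.cutoff_eq_zero hε hξ, hone] using h

lemma ae_eq_zero_of_mem_orthogonal_halfLine (hε : 0 < ε) {f : Lp ℂ 2 (volume : Measure ℝ)}
    (hf : f ∈ (halfLine ρ t ε)ᗮ) : ∀ᵐ ξ, t + ε ≤ ξ → f ξ = 0 := by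
  filter_upwards [(hρ.isCutoff t ε).mem_orthogonal_cutoffSpace.1 hf] with ξ h hξ
  have hzero : cutoff ρ t ε (2 * t - ξ) = 0 := hρ.cutoff_eq_zero hε (by linarith)
  simpa [hρ.cutoff_eq_one hε hξ, hzero] using h

lemma halfLine_le {s δ : ℝ} (hε : 0 < ε) (hδ : 0 < δ) (h : t + ε ≤ s - δ) :
    halfLine ρ s δ ≤ halfLine ρ t ε := by
  intro f hf
  have hzero := hρ.ae_eq_zero_of_mem_halfLine hδ hf
  refine mem_cutoffSpace.2 ?_
  filter_upwards [hzero, ae_reflect t hzero] with ξ hξ hξ'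
  rcases le_total ξ (t + ε) with hle | hle
  · rcases le_total ξ (t - ε) with hle' | hle'
    · simp [hξ (by linarith), hρ.cutoff_eq_zero hε hle']
    · simp [hξ (by linarith), hξ' (by linarith)]
  · have hcut : cutoff ρ t ε (2 * t - ξ) = 0 := hρ.cutoff_eq_zero hε (by linarith)
    simp [hcut, hξ' (by linarith)]

end IsRamp

end HalfLine

section HalfIntegerCosine

open Real

lemma integral_cos_int_mul {m : ℤ} (hm : m ≠ 0) : ∫ θ in 0..π, cos (m * θ) = 0 := by
  rw [intervalIntegral.integral_comp_mul_left _ (Int.cast_ne_zero.2 hm), integral_cos,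
    sin_int_mul_pi]
  simp

lemma integral_cos_add_half_mul_cos_add_half (k l : ℕ) :
    ∫ θ in 0..π, cos ((k + 1 / 2) * θ) * cos ((l + 1 / 2) * θ) = if k = l then π / 2 else 0 := by
  have hprod (θ : ℝ) : cos ((k + 1 / 2) * θ) * cos ((l + 1 / 2) * θ) =
      (1 / 2) * (cos ((k - l : ℤ) * θ) + cos ((k + l + 1 : ℤ) * θ)) := by
    have hsub : ((k - l : ℤ) : ℝ) * θ = (k + 1 / 2) * θ - (l + 1 / 2) * θ := by push_cast; ring
    have hadd : ((k + l + 1 : ℤ) : ℝ) * θ = (k + 1 / 2) * θ + (l + 1 / 2) * θ := by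
      push_cast; ring
    rw [hsub, hadd, cos_sub, cos_add]
    ring
  simp_rw [hprod]
  rw [intervalIntegral.integral_const_mul, intervalIntegral.integral_add
    (Continuous.intervalIntegrable (by fun_prop) _ _)
    (Continuous.intervalIntegrable (by fun_prop) _ _),
    integral_cos_int_mul (m := k + l + 1) (by lia)]
  split_ifs with hkl
  · simp [hkl]
    ring
  · rw [integral_cos_int_mul (m := k - l) (by lia)]
    simp

-- At `k = 0` the truncated `k - 1` is harmless: `θ ↦ cos (θ / 2)` is even.
lemma cos_add_half_mul_cos (k : ℕ) (θ : ℝ) : cos ((k + 1 / 2) * θ) * cos θ =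
    (1 / 2) * (cos (((k + 1 : ℕ) + 1 / 2) * θ) + cos (((k - 1 : ℕ) + 1 / 2) * θ)) := by
  have hadd : ((k + 1 : ℕ) + 1 / 2 : ℝ) * θ = (k + 1 / 2) * θ + θ := by push_cast; ring
  have hsub : cos (((k - 1 : ℕ) + 1 / 2) * θ) = cos ((k + 1 / 2) * θ - θ) := by
    rcases k with _ | k
    · rw [← cos_neg]; congr 1; push_cast; ring
    · congr 1; simp only [Nat.add_sub_cancel]; push_cast; ring
  rw [hadd, hsub, cos_add, cos_sub]
  ring

section Totality

variable {X : Type*} [MeasurableSpace X] {μ : Measure X} {F : X → ℂ} {θ : X → ℝ}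
  (hF : Integrable F μ) (hθ : AEMeasurable θ μ)
include hF hθ

lemma integrable_mul_cos_add_half_mul_comp_cos {φ : ℝ → ℝ} (hφ : Continuous φ) (k : ℕ) :
    Integrable (fun x => F x * (cos ((k + 1 / 2) * θ x) * φ (cos (θ x)) : ℝ)) μ := by
  obtain ⟨M, hM⟩ := (isCompact_Icc (a := (-1 : ℝ)) (b := 1)).exists_bound_of_continuousOn
    hφ.continuousOn
  have hmeas : AEStronglyMeasurable
      (fun x => ((cos ((k + 1 / 2) * θ x) * φ (cos (θ x)) : ℝ) : ℂ)) μ :=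
    ((by fun_prop : Continuous fun y : ℝ =>
      ((cos ((k + 1 / 2) * y) * φ (cos y) : ℝ) : ℂ)).comp_aestronglyMeasurable
      hθ.aestronglyMeasurable)
  refine hF.mul_bdd (c := 1 * M) hmeas (.of_forall fun x => ?_)
  rw [Complex.norm_real, norm_mul]
  exact mul_le_mul (abs_cos_le_one _) (hM _ (cos_mem_Icc _)) (norm_nonneg _) zero_le_one

variable (h : ∀ k : ℕ, ∫ x, F x * (cos ((k + 1 / 2) * θ x) : ℂ) ∂μ = 0)
include h

lemma integral_mul_cos_add_half_mul_eval_cos_eq_zero (p : Polynomial ℝ) (k : ℕ) :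
    ∫ x, F x * (cos ((k + 1 / 2) * θ x) * p.eval (cos (θ x)) : ℝ) ∂μ = 0 := by
  induction p using Polynomial.induction_on generalizing k with
  | C z =>
    simp only [Polynomial.eval_C, Complex.ofReal_mul, ← mul_assoc]
    rw [integral_mul_const]
    simpa using Or.inl (h k)
  | add p q hp hq =>
    simp only [Polynomial.eval_add, mul_add, Complex.ofReal_add]
    rw [integral_add, hp, hq, add_zero]
    exacts [mod_cast integrable_mul_cos_add_half_mul_comp_cos hF hθ p.continuous k,
      mod_cast integrable_mul_cos_add_half_mul_comp_cos hF hθ q.continuous k]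
  | monomial n z ih =>
    have hi := integrable_mul_cos_add_half_mul_comp_cos hF hθ
      (Polynomial.C z * Polynomial.X ^ n).continuous
    have hrec (x : X) : F x * (cos ((k + 1 / 2) * θ x) *
        (Polynomial.C z * Polynomial.X ^ (n + 1)).eval (cos (θ x)) : ℝ) = (1 / 2 : ℂ) *
        (F x * (cos (((k + 1 : ℕ) + 1 / 2) * θ x) *
          (Polynomial.C z * Polynomial.X ^ n).eval (cos (θ x)) : ℝ) +
        F x * (cos (((k - 1 : ℕ) + 1 / 2) * θ x) *
          (Polynomial.C z * Polynomial.X ^ n).eval (cos (θ x)) : ℝ)) := by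
      rw [pow_succ, ← mul_assoc, Polynomial.eval_mul_X, mul_comm _ (cos (θ x)), ← mul_assoc,
        cos_add_half_mul_cos]
      push_cast
      ring
    simp_rw [hrec]
    rw [integral_const_mul, integral_add (hi (k + 1)) (hi (k - 1)), ih, ih]
    simp

lemma integral_mul_cos_half_mul_comp_cos_eq_zero {φ : ℝ → ℝ} (hφ : Continuous φ) :
    ∫ x, F x * (cos ((1 / 2) * θ x) * φ (cos (θ x)) : ℝ) ∂μ = 0 := by
  have hbound (δ : ℝ) (hδ : 0 < δ) :
      ‖∫ x, F x * (cos ((1 / 2) * θ x) * φ (cos (θ x)) : ℝ) ∂μ‖ ≤ δ * ∫ x, ‖F x‖ ∂μ := by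
    obtain ⟨p, hp⟩ := exists_polynomial_near_of_continuousOn (-1) 1 φ hφ.continuousOn δ hδ
    have hpoly := integral_mul_cos_add_half_mul_eval_cos_eq_zero hF hθ h p 0
    have hiφ := integrable_mul_cos_add_half_mul_comp_cos hF hθ hφ 0
    have hip := integrable_mul_cos_add_half_mul_comp_cos hF hθ p.continuous 0
    simp only [CharP.cast_eq_zero, zero_add] at hpoly hiφ hip
    rw [← sub_zero (∫ x, _ ∂μ), ← hpoly, ← integral_sub hiφ hip, ← integral_const_mul]
    refine norm_integral_le_of_norm_le (hF.norm.const_mul δ) (.of_forall fun x => ?_)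
    rw [← mul_sub, norm_mul, ← Complex.ofReal_sub, ← mul_sub, Complex.norm_real, norm_mul,
      mul_comm δ, norm_sub_rev]
    refine mul_le_mul_of_nonneg_left ?_ (norm_nonneg _)
    exact (mul_le_mul (abs_cos_le_one _) (hp _ (cos_mem_Icc _)).le (abs_nonneg _)
      zero_le_one).trans_eq (one_mul δ)
  have hlim : Tendsto (fun δ => δ * ∫ x, ‖F x‖ ∂μ) (𝓝[>] 0) (𝓝 0) :=
    ((continuous_mul_const _).tendsto' 0 0 (zero_mul _)).mono_left nhdsWithin_le_nhds
  exact norm_le_zero_iff.1 (ge_of_tendsto hlim (eventually_mem_nhdsWithin.mono hbound))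

end Totality

section Interval

/-- The angle that runs from `0` to `π` as `ξ` runs through `[a, b)`. -/
def phase (a b ξ : ℝ) : ℝ := π * ((ξ - a) / (b - a))

/-- The cosine of half-integer frequency on `[a, b)`, which is even about `a` and odd about `b`. -/
def halfCos (a b : ℝ) (k : ℕ) (ξ : ℝ) : ℝ := cos ((k + 1 / 2) * phase a b ξ)

lemma continuous_phase (a b : ℝ) : Continuous (phase a b) := by
  unfold phase; fun_prop

lemma continuous_halfCos (a b : ℝ) (k : ℕ) : Continuous (halfCos a b k) :=
  continuous_cos.comp (continuous_const.mul (continuous_phase a b))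

lemma halfCos_reflect_left (a b : ℝ) (k : ℕ) (ξ : ℝ) :
    halfCos a b k (2 * a - ξ) = halfCos a b k ξ := by
  rw [halfCos, halfCos, phase, phase, ← cos_neg]
  congr 1
  ring

variable {a b : ℝ} (hab : a < b)
include hab

lemma halfCos_reflect_right (k : ℕ) (ξ : ℝ) : halfCos a b k (2 * b - ξ) = -halfCos a b k ξ := by
  have hne : b - a ≠ 0 := (sub_pos.2 hab).ne'
  have hphase : (k + 1 / 2) * phase a b (2 * b - ξ) =
      π - (k + 1 / 2) * phase a b ξ + k * (2 * π) := by
    unfold phase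
    field_simp
    ring
  rw [halfCos, hphase, cos_add_nat_mul_two_pi, cos_pi_sub, halfCos]

lemma integral_comp_phase (g : ℝ → ℝ) :
    ∫ ξ in a..b, g (phase a b ξ) = (b - a) / π * ∫ θ in 0..π, g θ := by
  have hne : b - a ≠ 0 := (sub_pos.2 hab).ne'
  have hphase (ξ : ℝ) : phase a b ξ = π / (b - a) * ξ - π / (b - a) * a := by
    unfold phase; ring
  simp_rw [hphase]
  rw [intervalIntegral.integral_comp_mul_sub _ (div_ne_zero pi_ne_zero hne), inv_div, smul_eq_mul,
    sub_self, ← mul_sub, div_mul_cancel₀ _ hne]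

lemma integral_halfCos_mul_halfCos (k l : ℕ) :
    ∫ ξ in a..b, halfCos a b k ξ * halfCos a b l ξ = if k = l then (b - a) / 2 else 0 := by
  rw [show ∫ ξ in a..b, halfCos a b k ξ * halfCos a b l ξ = _ from
      integral_comp_phase hab fun θ => cos ((k + 1 / 2) * θ) * cos ((l + 1 / 2) * θ),
    integral_cos_add_half_mul_cos_add_half, mul_ite, mul_zero]
  congr 1
  field_simp

lemma phase_mem_Icc {ξ : ℝ} (hξ : ξ ∈ Set.Icc a b) : phase a b ξ ∈ Set.Icc 0 π :=
  ⟨mul_nonneg pi_nonneg (div_nonneg (sub_nonneg.2 hξ.1) (sub_pos.2 hab).le),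
    mul_le_of_le_one_right pi_nonneg ((div_le_one (sub_pos.2 hab)).2 (by linarith [hξ.2]))⟩

lemma halfCos_zero_pos {ξ : ℝ} (hξ : ξ ∈ Set.Ioo a b) : 0 < halfCos a b 0 ξ := by
  have hpos : 0 < (ξ - a) / (b - a) := div_pos (sub_pos.2 hξ.1) (sub_pos.2 hab)
  have hlt : (ξ - a) / (b - a) < 1 := (div_lt_one (sub_pos.2 hab)).2 (by linarith [hξ.2])
  apply cos_pos_of_mem_Ioo
  constructor <;> unfold phase <;> push_cast <;> nlinarith [pi_pos]

lemma ae_eq_zero_of_integral_mul_halfCos_eq_zero {F : ℝ → ℂ}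
    (hF : IntervalIntegrable F volume a b)
    (h : ∀ k, ∫ ξ in a..b, F ξ * (halfCos a b k ξ : ℂ) = 0) :
    ∀ᵐ ξ, ξ ∈ Set.Ioo a b → F ξ = 0 := by
  have hcont : Continuous fun ξ => (halfCos a b 0 ξ : ℂ) :=
    Complex.continuous_ofReal.comp (continuous_halfCos a b 0)
  have hloc : LocallyIntegrableOn (fun ξ => F ξ * (halfCos a b 0 ξ : ℂ)) (Set.Ioo a b) :=
    (((intervalIntegrable_iff_integrableOn_Ioc_of_le hab.le).1
      (hF.mul_continuousOn hcont.continuousOn)).mono_set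
      Set.Ioo_subset_Ioc_self).locallyIntegrableOn
  have hprod := isOpen_Ioo.ae_eq_zero_of_integral_contDiff_smul_eq_zero hloc fun g hg _ hgs => ?_
  · filter_upwards [hprod] with ξ hξ hmem
    exact (mul_eq_zero.1 (hξ hmem)).resolve_right (mod_cast (halfCos_zero_pos hab hmem).ne')
  have htest : ∫ ξ in Set.Ioc a b, F ξ * (cos ((1 / 2) * phase a b ξ) *
      g (a + (b - a) * (arccos (cos (phase a b ξ)) / π)) : ℝ) = 0 :=
    integral_mul_cos_half_mul_comp_cos_eq_zero (φ := fun y => g (a + (b - a) * (arccos y / π)))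
      ((intervalIntegrable_iff_integrableOn_Ioc_of_le hab.le).1 hF)
      (continuous_phase a b).aemeasurable
      (fun k => by simpa [halfCos, intervalIntegral.integral_of_le hab.le] using h k)
      (hg.continuous.comp (by fun_prop))
  have hsupp : ∀ ξ ∉ Set.Ioc a b, g ξ • (F ξ * (halfCos a b 0 ξ : ℂ)) = 0 := fun ξ hξ => by
    rw [image_eq_zero_of_notMem_tsupport fun hs => hξ (Set.Ioo_subset_Ioc_self (hgs hs)), zero_smul]
  rw [← setIntegral_eq_integral_of_forall_compl_eq_zero hsupp, ← htest]
  refine setIntegral_congr_fun measurableSet_Ioc fun ξ hξ => ?_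
  have hmem := phase_mem_Icc hab (Set.Ioc_subset_Icc_self hξ)
  have hinv : a + (b - a) * (phase a b ξ / π) = ξ := by
    have hne : b - a ≠ 0 := (sub_pos.2 hab).ne'
    unfold phase
    field_simp
    ring
  simp only [arccos_cos hmem.1 hmem.2, hinv, halfCos, CharP.cast_eq_zero, zero_add,
    Complex.real_smul, Complex.ofReal_mul]
  ring

end Interval

end HalfIntegerCosine

section LocalCosine

lemma brushletHat_eq (ρ : ℝ → ℝ) (a b ε ε' : ℝ) (k : ℕ) (ξ : ℝ) : brushletHat ρ a b ε ε' k ξ =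
    √(2 / (b - a)) * bell ρ a b ε ε' ξ * halfCos a b k ξ := by
  rw [brushletHat, halfCos, phase]
  congr 2
  ring

lemma integral_eq_intervalIntegral_add_reflect {E : Type*} [NormedAddCommGroup E] [NormedSpace ℝ E]
    {a b : ℝ} {G : ℝ → E} (hG : Integrable G)
    (hs : Function.support G ⊆ Set.Ioc (2 * a - b) (2 * b - a)) :
    ∫ ξ, G ξ = ∫ ξ in a..b, (G ξ + G (2 * a - ξ) + G (2 * b - ξ)) := by
  have hi (c d : ℝ) : IntervalIntegrable G volume c d := hG.intervalIntegrable
  have hr (t c d : ℝ) : IntervalIntegrable (fun ξ => G (2 * t - ξ)) volume c d :=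
    (hG.comp_sub_left (2 * t)).intervalIntegrable
  rw [intervalIntegral.integral_add ((hi _ _).add (hr _ _ _)) (hr _ _ _),
    intervalIntegral.integral_add (hi _ _) (hr _ _ _), intervalIntegral.integral_comp_sub_left,
    intervalIntegral.integral_comp_sub_left,
    ← intervalIntegral.integral_eq_integral_of_support_subset hs,
    ← intervalIntegral.integral_add_adjacent_intervals (hi (2 * a - b) a) (hi a (2 * b - a)),
    ← intervalIntegral.integral_add_adjacent_intervals (hi a b) (hi b (2 * b - a)),
    show 2 * a - a = a by ring, show 2 * b - b = b by ring]
  abel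

/-- The folding of the windowed function `w · f` onto `[a, b]`, evenly about `a` and oddly about
`b`; pairing it with a function on `[a, b]` amounts to pairing `w · f` with the extension of that
function which is even about `a` and odd about `b`. -/
def fold (a b : ℝ) (w : ℝ → ℝ) (f : ℝ → ℂ) (ξ : ℝ) : ℂ :=
  w ξ * f ξ + w (2 * a - ξ) * f (2 * a - ξ) - w (2 * b - ξ) * f (2 * b - ξ)

/-- The cutoff radii `ε` at `a` and `ε'` at `b` are positive and fit into the interval `[a, b)`. -/
structure Admissible (a b ε ε' : ℝ) : Prop where
  left_pos : 0 < ε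
  right_pos : 0 < ε'
  add_le : ε + ε' ≤ b - a

namespace Admissible

variable {ρ : ℝ → ℝ} {a b ε ε' : ℝ} (hI : Admissible a b ε ε') (hρ : IsRamp ρ)

include hI in
lemma lt : a < b := by linarith [hI.left_pos, hI.right_pos, hI.add_le]

section Bell

include hI hρ

lemma bell_eq_left {ξ : ℝ} (h : ξ ≤ a + ε) : bell ρ a b ε ε' ξ = cutoff ρ a ε ξ := by
  rw [bell_eq, hρ.cutoff_eq_one hI.right_pos (by linarith [hI.add_le]), mul_one]

lemma bell_eq_right {ξ : ℝ} (h : b - ε' ≤ ξ) :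
    bell ρ a b ε ε' ξ = cutoff ρ b ε' (2 * b - ξ) := by
  rw [bell_eq, hρ.cutoff_eq_one hI.left_pos (by linarith [hI.add_le]), one_mul]

lemma bell_eq_zero_left {ξ : ℝ} (h : ξ ≤ a - ε) : bell ρ a b ε ε' ξ = 0 := by
  rw [bell_eq, hρ.cutoff_eq_zero hI.left_pos h, zero_mul]

lemma bell_eq_zero_right {ξ : ℝ} (h : b + ε' ≤ ξ) : bell ρ a b ε ε' ξ = 0 := by
  rw [bell_eq, hρ.cutoff_eq_zero (t := b) hI.right_pos (by linarith), mul_zero]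

lemma support_bell_subset : Function.support (bell ρ a b ε ε') ⊆ Set.Ioo (a - ε) (b + ε') :=
  fun _ hξ => ⟨lt_of_not_ge fun h => hξ (hI.bell_eq_zero_left hρ h),
    lt_of_not_ge fun h => hξ (hI.bell_eq_zero_right hρ h)⟩

lemma bell_sq_add_bell_sq_left {ξ : ℝ} (h : ξ ∈ Set.Icc (a - ε) (a + ε)) :
    bell ρ a b ε ε' ξ ^ 2 + bell ρ a b ε ε' (2 * a - ξ) ^ 2 = 1 := by
  rw [hI.bell_eq_left hρ h.2, hI.bell_eq_left hρ (by linarith [h.1])]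
  exact (hρ.isCutoff a ε).sq_add_sq_reflect ξ

lemma bell_sq_add_bell_sq_right {ξ : ℝ} (h : ξ ∈ Set.Icc (b - ε') (b + ε')) :
    bell ρ a b ε ε' ξ ^ 2 + bell ρ a b ε ε' (2 * b - ξ) ^ 2 = 1 := by
  rw [hI.bell_eq_right hρ h.1, hI.bell_eq_right hρ (by linarith [h.2])]
  exact (hρ.isCutoff b ε').reflect.sq_add_sq_reflect ξ

lemma bell_sq_add_bell_sq_add_bell_sq {ξ : ℝ} (hξ : ξ ∈ Set.Icc a b) :
    bell ρ a b ε ε' ξ ^ 2 + bell ρ a b ε ε' (2 * a - ξ) ^ 2 + bell ρ a b ε ε' (2 * b - ξ) ^ 2 =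
      1 := by
  have hε := hI.left_pos
  have hε' := hI.right_pos
  have hle := hI.add_le
  obtain ⟨ha, hb⟩ := hξ
  rcases le_total ξ (a + ε) with h | h
  · rw [hI.bell_sq_add_bell_sq_left hρ ⟨by linarith, h⟩,
      hI.bell_eq_zero_right hρ (by linarith)]
    norm_num
  · rw [hI.bell_eq_zero_left hρ (ξ := 2 * a - ξ) (by linarith)]
    rcases le_total ξ (b - ε') with h' | h'
    · rw [hI.bell_eq_zero_right hρ (ξ := 2 * b - ξ) (by linarith), bell_eq,
        hρ.cutoff_eq_one hε h, hρ.cutoff_eq_one hε' (by linarith)]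
      norm_num
    · linarith [hI.bell_sq_add_bell_sq_right hρ (ξ := ξ) ⟨h', by linarith⟩]

lemma cutoff_reflect_mul_bell (ξ : ℝ) :
    cutoff ρ a ε (2 * a - ξ) * bell ρ a b ε ε' ξ =
      cutoff ρ a ε ξ * bell ρ a b ε ε' (2 * a - ξ) := by
  rcases le_total ξ (a - ε) with h | h
  · rw [hI.bell_eq_zero_left hρ h, hρ.cutoff_eq_zero hI.left_pos h, mul_zero, zero_mul]
  rcases le_total (a + ε) ξ with h' | h'
  · rw [hI.bell_eq_zero_left hρ (ξ := 2 * a - ξ) (by linarith),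
      hρ.cutoff_eq_zero (ξ := 2 * a - ξ) hI.left_pos (by linarith), mul_zero, zero_mul]
  · rw [hI.bell_eq_left hρ h', hI.bell_eq_left hρ (by linarith), mul_comm]

lemma cutoff_mul_bell (ξ : ℝ) :
    cutoff ρ b ε' ξ * bell ρ a b ε ε' ξ =
      cutoff ρ b ε' (2 * b - ξ) * bell ρ a b ε ε' (2 * b - ξ) := by
  rcases le_total ξ (b - ε') with h | h
  · rw [hI.bell_eq_zero_right hρ (ξ := 2 * b - ξ) (by linarith),
      hρ.cutoff_eq_zero hI.right_pos h, mul_zero, zero_mul]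
  rcases le_total (b + ε') ξ with h' | h'
  · rw [hI.bell_eq_zero_right hρ h',
      hρ.cutoff_eq_zero (t := b) (ξ := 2 * b - ξ) hI.right_pos (by linarith), mul_zero, zero_mul]
  · rw [hI.bell_eq_right hρ h, hI.bell_eq_right hρ (ξ := 2 * b - ξ) (by linarith), mul_comm,
      sub_sub_cancel]

omit hI in
lemma continuous_bell : Continuous (bell ρ a b ε ε') := by
  have := hρ.smooth.continuous
  unfold bell
  fun_prop

lemma hasCompactSupport_bell : HasCompactSupport (bell ρ a b ε ε') :=
  HasCompactSupport.of_support_subset_isCompact isCompact_Icc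
    ((hI.support_bell_subset hρ).trans Set.Ioo_subset_Icc_self)

lemma support_bell_subset_Ioc :
    Function.support (bell ρ a b ε ε') ⊆ Set.Ioc (2 * a - b) (2 * b - a) := fun ξ hξ => by
  have h := hI.support_bell_subset hρ hξ
  have := hI.left_pos
  have := hI.right_pos
  have := hI.add_le
  exact ⟨by linarith [h.1], by linarith [h.2]⟩

end Bell

include hρ in
lemma contDiff_brushletHat (k : ℕ) : ContDiff ℝ ∞ (brushletHat ρ a b ε ε' k) := by
  have hleft : ContDiff ℝ ∞ fun ξ : ℝ => ρ ((ξ - a) / ε) := hρ.smooth.comp (by fun_prop)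
  have hright : ContDiff ℝ ∞ fun ξ : ℝ => ρ ((b - ξ) / ε') := hρ.smooth.comp (by fun_prop)
  exact (contDiff_const.mul (hleft.mul hright)).mul (by fun_prop)

include hI hρ

lemma hasCompactSupport_brushletHat (k : ℕ) : HasCompactSupport (brushletHat ρ a b ε ε' k) :=
  ((hI.hasCompactSupport_bell hρ).mul_left (f := fun _ => √(2 / (b - a)))).mul_right

/-- The local cosine function of an interval as a Schwartz function. -/
def localCosineSchwartz (k : ℕ) : SchwartzMap ℝ ℂ :=
  HasCompactSupport.toSchwartzMap (f := fun ξ => (brushletHat ρ a b ε ε' k ξ : ℂ))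
    ((hI.hasCompactSupport_brushletHat hρ k).comp_left Complex.ofReal_zero)
    (Complex.ofRealCLM.contDiff.comp (contDiff_brushletHat hρ k))

/-- The local cosine function of an interval as an element of `L²(ℝ)`. -/
def localCosine (k : ℕ) : Lp ℂ 2 (volume : Measure ℝ) := (hI.localCosineSchwartz hρ k).toLp 2

lemma coeFn_localCosine (k : ℕ) :
    ⇑(hI.localCosine hρ k) =ᵐ[volume] fun ξ => (brushletHat ρ a b ε ε' k ξ : ℂ) :=
  (hI.localCosineSchwartz hρ k).coeFn_toLp 2

lemma localCosine_mem_orthoDiff (k : ℕ) :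
    hI.localCosine hρ k ∈ orthoDiff (halfLine ρ a ε) (halfLine ρ b ε') := by
  have h := hI.coeFn_localCosine hρ k
  refine mem_orthoDiff.2 ⟨mem_cutoffSpace.2 ?_, (hρ.isCutoff b ε').mem_orthogonal_cutoffSpace.2 ?_⟩
  · filter_upwards [h, ae_reflect a h] with ξ h h'
    rw [h, h']
    norm_cast
    rw [brushletHat_eq, brushletHat_eq, halfCos_reflect_left]
    linear_combination √(2 / (b - a)) * halfCos a b k ξ * hI.cutoff_reflect_mul_bell hρ ξ
  · filter_upwards [h, ae_reflect b h] with ξ h h'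
    rw [h, h']
    norm_cast
    rw [brushletHat_eq, brushletHat_eq, halfCos_reflect_right hI.lt]
    linear_combination √(2 / (b - a)) * halfCos a b k ξ * hI.cutoff_mul_bell hρ ξ

lemma integrable_bell_mul (f : Lp ℂ 2 (volume : Measure ℝ)) :
    Integrable fun ξ => (bell ρ a b ε ε' ξ : ℂ) * f ξ :=
  have hbell : MemLp (fun ξ => (bell ρ a b ε ε' ξ : ℂ)) 2 volume :=
    (Complex.continuous_ofReal.comp (continuous_bell hρ)).memLp_of_hasCompactSupport
      ((hI.hasCompactSupport_bell hρ).comp_left Complex.ofReal_zero)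
  hbell.integrable_mul (Lp.memLp f)

lemma inner_localCosine (f : Lp ℂ 2 (volume : Measure ℝ)) (k : ℕ) :
    ⟪hI.localCosine hρ k, f⟫_ℂ =
      √(2 / (b - a)) * ∫ ξ in a..b, fold a b (bell ρ a b ε ε') f ξ * halfCos a b k ξ := by
  have hprod : (fun ξ => ⟪hI.localCosine hρ k ξ, f ξ⟫_ℂ) =ᵐ[volume] fun ξ =>
      (√(2 / (b - a)) : ℂ) * ((bell ρ a b ε ε' ξ : ℂ) * f ξ * halfCos a b k ξ) := by
    filter_upwards [hI.coeFn_localCosine hρ k] with ξ h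
    rw [h, RCLike.inner_apply, Complex.conj_ofReal, brushletHat_eq]
    push_cast
    ring
  have hint : Integrable fun ξ => (bell ρ a b ε ε' ξ : ℂ) * f ξ * halfCos a b k ξ :=
    (hI.integrable_bell_mul hρ f).mul_bdd (c := 1)
      (Complex.continuous_ofReal.comp (continuous_halfCos a b k)).aestronglyMeasurable
      (.of_forall fun ξ => (Complex.norm_real _).trans_le (Real.abs_cos_le_one _))
  have hsupp : Function.support (fun ξ => (bell ρ a b ε ε' ξ : ℂ) * f ξ * halfCos a b k ξ) ⊆
      Set.Ioc (2 * a - b) (2 * b - a) :=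
    fun ξ hξ => hI.support_bell_subset_Ioc hρ fun h => hξ (by simp [h])
  rw [L2.inner_def, integral_congr_ae hprod, integral_const_mul,
    integral_eq_intervalIntegral_add_reflect hint hsupp]
  congr 1
  refine intervalIntegral.integral_congr fun ξ _ => ?_
  simp only [fold, halfCos_reflect_left, halfCos_reflect_right hI.lt]
  push_cast
  ring

lemma fold_localCosine (k : ℕ) : ∀ᵐ ξ, ξ ∈ Set.Icc a b →
    fold a b (bell ρ a b ε ε') (hI.localCosine hρ k) ξ = √(2 / (b - a)) * halfCos a b k ξ := by
  have h := hI.coeFn_localCosine hρ k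
  filter_upwards [h, ae_reflect a h, ae_reflect b h] with ξ h ha hb hξ
  rw [fold, h, ha, hb]
  norm_cast
  simp only [brushletHat_eq, halfCos_reflect_left, halfCos_reflect_right hI.lt]
  linear_combination √(2 / (b - a)) * halfCos a b k ξ *
    hI.bell_sq_add_bell_sq_add_bell_sq hρ hξ

lemma orthonormal_localCosine : Orthonormal ℂ (hI.localCosine hρ) := by
  have hpos : 0 < b - a := sub_pos.2 hI.lt
  rw [orthonormal_iff_ite]
  intro k l
  have hfold : ∫ ξ in a..b, fold a b (bell ρ a b ε ε') (hI.localCosine hρ l) ξ * halfCos a b k ξ =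
      ∫ ξ in a..b, ((√(2 / (b - a)) * (halfCos a b k ξ * halfCos a b l ξ) : ℝ) : ℂ) := by
    refine intervalIntegral.integral_congr_ae ?_
    filter_upwards [hI.fold_localCosine hρ l] with ξ h hξ
    rw [h (Set.Ioc_subset_Icc_self (by rwa [Set.uIoc_of_le hI.lt.le] at hξ))]
    push_cast
    ring
  rw [inner_localCosine, hfold, intervalIntegral.integral_ofReal,
    intervalIntegral.integral_const_mul, integral_halfCos_mul_halfCos hI.lt]
  norm_cast
  rw [← mul_assoc, Real.mul_self_sqrt (by positivity)]
  split_ifs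
  · norm_cast; field_simp
  · simp

lemma ae_bell_reflect_left_mul {f : Lp ℂ 2 (volume : Measure ℝ)} (hf : f ∈ halfLine ρ a ε) :
    ∀ᵐ ξ, (bell ρ a b ε ε' (2 * a - ξ) : ℂ) * f ξ = bell ρ a b ε ε' ξ * f (2 * a - ξ) := by
  filter_upwards [mem_cutoffSpace.1 hf] with ξ h
  have hsq := (hρ.isCutoff a ε).sq_add_sq_reflect_complex ξ
  have hbell : (cutoff ρ a ε (2 * a - ξ) : ℂ) * bell ρ a b ε ε' ξ =
      cutoff ρ a ε ξ * bell ρ a b ε ε' (2 * a - ξ) := mod_cast hI.cutoff_reflect_mul_bell hρ ξ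
  linear_combination (bell ρ a b ε ε' ξ * f (2 * a - ξ) - bell ρ a b ε ε' (2 * a - ξ) * f ξ) * hsq +
    (cutoff ρ a ε ξ * bell ρ a b ε ε' ξ +
      cutoff ρ a ε (2 * a - ξ) * bell ρ a b ε ε' (2 * a - ξ)) * h -
    (cutoff ρ a ε ξ * f ξ + cutoff ρ a ε (2 * a - ξ) * f (2 * a - ξ)) * hbell

lemma ae_bell_reflect_right_mul {f : Lp ℂ 2 (volume : Measure ℝ)} (hf : f ∈ (halfLine ρ b ε')ᗮ) :
    ∀ᵐ ξ, (bell ρ a b ε ε' (2 * b - ξ) : ℂ) * f ξ = -(bell ρ a b ε ε' ξ * f (2 * b - ξ)) := by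
  filter_upwards [(hρ.isCutoff b ε').mem_orthogonal_cutoffSpace.1 hf] with ξ h
  have hsq := (hρ.isCutoff b ε').sq_add_sq_reflect_complex ξ
  have hbell : (cutoff ρ b ε' ξ : ℂ) * bell ρ a b ε ε' ξ =
      cutoff ρ b ε' (2 * b - ξ) * bell ρ a b ε ε' (2 * b - ξ) := mod_cast hI.cutoff_mul_bell hρ ξ
  linear_combination (-(bell ρ a b ε ε' ξ * f (2 * b - ξ)) -
      bell ρ a b ε ε' (2 * b - ξ) * f ξ) * hsq +
    (cutoff ρ b ε' (2 * b - ξ) * bell ρ a b ε ε' ξ +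
      cutoff ρ b ε' ξ * bell ρ a b ε ε' (2 * b - ξ)) * h -
    (cutoff ρ b ε' (2 * b - ξ) * f ξ - cutoff ρ b ε' ξ * f (2 * b - ξ)) * hbell

lemma eq_zero_of_fold_eq_zero {f : Lp ℂ 2 (volume : Measure ℝ)}
    (hf : f ∈ orthoDiff (halfLine ρ a ε) (halfLine ρ b ε'))
    (hfold : ∀ᵐ ξ, ξ ∈ Set.Ioo a b → fold a b (bell ρ a b ε ε') f ξ = 0) : f = 0 := by
  have hε := hI.left_pos
  have hε' := hI.right_pos
  have hle := hI.add_le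
  obtain ⟨hfa, hfb⟩ := mem_orthoDiff.1 hf
  rw [Lp.eq_zero_iff_ae_eq_zero]
  filter_upwards [hfold, ae_reflect a hfold, ae_reflect b hfold, volume.ae_ne a, volume.ae_ne b,
    hI.ae_bell_reflect_left_mul hρ hfa, hI.ae_bell_reflect_right_mul hρ hfb,
    hρ.ae_eq_zero_of_mem_halfLine hε hfa, hρ.ae_eq_zero_of_mem_orthogonal_halfLine hε' hfb]
    with ξ hfold hfold_a hfold_b hne_a hne_b ha hb hzero_a hzero_b
  rw [Pi.zero_apply]
  rcases lt_or_gt_of_ne hne_a with hlt | hgt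
  · rcases le_total ξ (a - ε) with h | h
    · exact hzero_a h
    have hsq : (bell ρ a b ε ε' ξ : ℂ) ^ 2 + (bell ρ a b ε ε' (2 * a - ξ) : ℂ) ^ 2 = 1 :=
      mod_cast hI.bell_sq_add_bell_sq_left hρ (ξ := ξ) ⟨h, by linarith⟩
    have hzero := hfold_a ⟨by linarith, by linarith⟩
    rw [fold, sub_sub_cancel, hI.bell_eq_zero_right hρ (ξ := 2 * b - (2 * a - ξ)) (by linarith),
      Complex.ofReal_zero, zero_mul] at hzero
    linear_combination (-f ξ) * hsq + bell ρ a b ε ε' (2 * a - ξ) * ha +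
      bell ρ a b ε ε' ξ * hzero
  rcases lt_or_gt_of_ne hne_b with hlt | hgt'
  · have hsq : (bell ρ a b ε ε' ξ : ℂ) ^ 2 + (bell ρ a b ε ε' (2 * a - ξ) : ℂ) ^ 2 +
        (bell ρ a b ε ε' (2 * b - ξ) : ℂ) ^ 2 = 1 :=
      mod_cast hI.bell_sq_add_bell_sq_add_bell_sq hρ ⟨hgt.le, hlt.le⟩
    have hzero := hfold ⟨hgt, hlt⟩
    rw [fold] at hzero
    linear_combination (-f ξ) * hsq + bell ρ a b ε ε' (2 * a - ξ) * ha +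
      bell ρ a b ε ε' (2 * b - ξ) * hb + bell ρ a b ε ε' ξ * hzero
  · rcases le_total (b + ε') ξ with h | h
    · exact hzero_b h
    have hsq : (bell ρ a b ε ε' ξ : ℂ) ^ 2 + (bell ρ a b ε ε' (2 * b - ξ) : ℂ) ^ 2 = 1 :=
      mod_cast hI.bell_sq_add_bell_sq_right hρ (ξ := ξ) ⟨by linarith, h⟩
    have hzero := hfold_b ⟨by linarith, by linarith⟩
    rw [fold, sub_sub_cancel, hI.bell_eq_zero_left hρ (ξ := 2 * a - (2 * b - ξ)) (by linarith),
      Complex.ofReal_zero, zero_mul] at hzero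
    linear_combination (-f ξ) * hsq + bell ρ a b ε ε' (2 * b - ξ) * hb -
      bell ρ a b ε ε' ξ * hzero

lemma eq_zero_of_inner_localCosine_eq_zero {f : Lp ℂ 2 (volume : Measure ℝ)}
    (hf : f ∈ orthoDiff (halfLine ρ a ε) (halfLine ρ b ε'))
    (h : ∀ k, ⟪hI.localCosine hρ k, f⟫_ℂ = 0) : f = 0 := by
  have hint := hI.integrable_bell_mul hρ f
  have hsqrt : √(2 / (b - a)) ≠ 0 := (Real.sqrt_pos.2 (div_pos two_pos (sub_pos.2 hI.lt))).ne'
  refine hI.eq_zero_of_fold_eq_zero hρ hf (ae_eq_zero_of_integral_mul_halfCos_eq_zero hI.lt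
    ((hint.add (hint.comp_sub_left (2 * a))).sub
      (hint.comp_sub_left (2 * b))).intervalIntegrable fun k => ?_)
  have hk := h k
  rw [inner_localCosine, mul_eq_zero] at hk
  exact hk.resolve_left (mod_cast hsqrt)

/-- The local cosine functions of an interval, as an orthonormal basis of the space of `L²`
functions that live smoothly on the interval. -/
def localCosineBasis : HilbertBasis ℕ ℂ (orthoDiff (halfLine ρ a ε) (halfLine ρ b ε')) :=
  HilbertBasis.mkOfOrthogonalEqBot
    (v := Set.codRestrict (hI.localCosine hρ) _ (hI.localCosine_mem_orthoDiff hρ))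
    ((hI.orthonormal_localCosine hρ).codRestrict _ _) <| by
      refine (Submodule.eq_bot_iff _).2 fun f hf => Subtype.ext ?_
      exact hI.eq_zero_of_inner_localCosine_eq_zero hρ f.2 fun k =>
        hf _ (Submodule.subset_span ⟨k, rfl⟩)

lemma coe_localCosineBasis (k : ℕ) : (hI.localCosineBasis hρ k : Lp ℂ 2 (volume : Measure ℝ)) =
    hI.localCosine hρ k := by
  rw [localCosineBasis, HilbertBasis.coe_mkOfOrthogonalEqBot, Set.val_codRestrict_apply]

end Admissible

end LocalCosine

section FourierTransform

variable {ρ : ℝ → ℝ} {a b ε ε' c : ℝ}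

lemma Admissible.div_const (hI : Admissible a b ε ε') (hc : 0 < c) :
    Admissible (a / c) (b / c) (ε / c) (ε' / c) where
  left_pos := div_pos hI.left_pos hc
  right_pos := div_pos hI.right_pos hc
  add_le := by
    rw [← add_div, ← sub_div]
    exact div_le_div_of_nonneg_right hI.add_le hc.le

lemma bell_div_const (ρ : ℝ → ℝ) (a b ε ε' : ℝ) (hc : c ≠ 0) (ξ : ℝ) :
    bell ρ (a / c) (b / c) (ε / c) (ε' / c) ξ = bell ρ a b ε ε' (c * ξ) := by
  have hξ : ξ = c * ξ / c := (mul_div_cancel_left₀ ξ hc).symm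
  rw [bell, bell]
  congr 2
  · rw [hξ, ← sub_div, div_div_div_cancel_right₀ hc, ← hξ]
  · rw [hξ, ← sub_div, div_div_div_cancel_right₀ hc, ← hξ]

lemma brushletHat_div_const (ρ : ℝ → ℝ) (a b ε ε' : ℝ) (hc : 0 < c) (k : ℕ) (ξ : ℝ) :
    brushletHat ρ (a / c) (b / c) (ε / c) (ε' / c) k ξ =
      √c * brushletHat ρ a b ε ε' k (c * ξ) := by
  have hratio : (ξ - a / c) / (b / c - a / c) = (c * ξ - a) / (b - a) := by
    rw [← sub_div, ← mul_div_mul_left _ _ hc.ne', mul_sub, mul_div_cancel₀ _ hc.ne',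
      mul_div_cancel₀ _ hc.ne']
  have hsqrt : √(2 / (b / c - a / c)) = √c * √(2 / (b - a)) := by
    rw [← Real.sqrt_mul hc.le, ← sub_div, div_div_eq_mul_div, mul_div_assoc', mul_comm]
  rw [brushletHat, brushletHat, bell_div_const ρ a b ε ε' hc.ne', hratio, hsqrt]
  ring

lemma integral_eq_mul_integral_comp_mul_left {E : Type*} [NormedAddCommGroup E] [NormedSpace ℝ E]
    (f : ℝ → E) (hc : 0 < c) : ∫ ξ, f ξ = c • ∫ ξ, f (c * ξ) := by
  rw [Measure.integral_comp_mul_left, abs_of_pos (inv_pos.2 hc), smul_inv_smul₀ hc.ne']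

/-- The substitution `ξ = 2πv` passes from the unitary normalization of the Fourier transform to
the normalization with kernel `exp (2πixv)`. -/
lemma brushlet_eq_integral (ρ : ℝ → ℝ) (a b ε ε' : ℝ) (k : ℕ) (x : ℝ) :
    brushlet ρ a b ε ε' k x = ∫ v : ℝ, Complex.exp (↑(2 * Real.pi * (v * x)) * Complex.I) *
      brushletHat ρ (a / (2 * Real.pi)) (b / (2 * Real.pi)) (ε / (2 * Real.pi))
        (ε' / (2 * Real.pi)) k v := by
  have hconst : (√(2 * Real.pi))⁻¹ * (2 * Real.pi) = √(2 * Real.pi) :=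
    (inv_mul_eq_iff_eq_mul₀ (Real.sqrt_pos.2 Real.two_pi_pos).ne').2
      (Real.mul_self_sqrt Real.two_pi_pos.le).symm
  rw [brushlet, integral_eq_mul_integral_comp_mul_left _ Real.two_pi_pos, Complex.real_smul,
    ← mul_assoc, ← Complex.ofReal_mul, hconst, ← integral_const_mul]
  refine integral_congr_ae (.of_forall fun v => ?_)
  have hexp : Complex.I * x * (2 * Real.pi * v : ℝ) = ↑(2 * Real.pi * (v * x)) * Complex.I := by
    push_cast
    ring
  simp only [brushletHat_div_const ρ a b ε ε' Real.two_pi_pos, Complex.ofReal_mul (√_), hexp]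
  ring

lemma coeFn_fourierInv_localCosine (hρ : IsRamp ρ) (hI : Admissible a b ε ε') (k : ℕ) :
    ⇑((Lp.fourierTransformₗᵢ ℝ ℂ).symm ((hI.div_const Real.two_pi_pos).localCosine hρ k))
      =ᵐ[volume] brushlet ρ a b ε ε' k := by
  have hI' := hI.div_const Real.two_pi_pos
  have hLp : (Lp.fourierTransformₗᵢ ℝ ℂ).symm (hI'.localCosine hρ k) =
      (FourierTransformInv.fourierInv (hI'.localCosineSchwartz hρ k) : SchwartzMap ℝ ℂ).toLp 2 :=
    SchwartzMap.toLp_fourierInv_eq _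
  rw [hLp]
  filter_upwards [SchwartzMap.coeFn_toLp (FourierTransformInv.fourierInv
    (hI'.localCosineSchwartz hρ k) : SchwartzMap ℝ ℂ) 2 volume] with x hx
  rw [hx, brushlet_eq_integral, SchwartzMap.fourierInv_coe, Real.fourierInv_eq']
  simp only [RCLike.inner_apply', conj_trivial, smul_eq_mul]
  rfl

end FourierTransform

section LevelRadius

variable {α : ℝ} {j : ℤ}

/-- The radius of `A_j`, completed by the value `1` at `j = 0`, where `radius` is not meaningful.
Since `A_{-1} = A_1`, the levels `-1`, `0` and `1` then share the radius `1`. -/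
def levelRadius (α : ℝ) (j : ℤ) : ℝ := if j = 0 then 1 else radius α j

lemma levelRadius_of_ne_zero (hj : j ≠ 0) : levelRadius α j = radius α j := if_neg hj

lemma IsLevel.levelRadius_eq (hj : IsLevel j) : levelRadius α j = radius α j :=
  levelRadius_of_ne_zero (by rcases hj with h | h <;> lia)

lemma IsLevel.levelRadius_sub_one (hj : IsLevel j) :
    levelRadius α (j - 1) = radius α (j - 1) :=
  levelRadius_of_ne_zero (by rcases hj with h | h <;> lia)

lemma levelRadius_neg_one : levelRadius α (-1) = 1 := by simp [levelRadius, radius]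

lemma eq_zero_or_eq_one_of_not_isLevel (hj : ¬IsLevel j) : j = 0 ∨ j = 1 := by
  unfold IsLevel at hj
  lia

lemma levelRadius_of_not_isLevel (hj : ¬IsLevel j) : levelRadius α j = 1 := by
  obtain rfl | rfl := eq_zero_or_eq_one_of_not_isLevel hj <;> simp [levelRadius, radius]

lemma levelRadius_sub_one_of_not_isLevel (hj : ¬IsLevel j) :
    levelRadius α (j - 1) = levelRadius α j := by
  obtain rfl | rfl := eq_zero_or_eq_one_of_not_isLevel hj <;> simp [levelRadius, radius]

lemma tendsto_levelRadius_atTop (hα : α < 1) : Tendsto (levelRadius α) atTop atTop := by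
  have hpow := tendsto_rpow_atTop (one_div_pos.2 (sub_pos.2 hα))
  refine (hpow.comp (tendsto_intCast_atTop_atTop (R := ℝ))).congr' ?_
  filter_upwards [eventually_gt_atTop 0] with j hj
  rw [levelRadius_of_ne_zero hj.ne', radius, if_pos hj, Function.comp_apply]

lemma tendsto_levelRadius_atBot (hα : α < 1) : Tendsto (levelRadius α) atBot (𝓝 0) := by
  have hpow := tendsto_rpow_neg_atTop (one_div_pos.2 (sub_pos.2 hα))
  have habs : Tendsto (fun j : ℤ => |(j : ℝ)|) atBot atTop :=
    tendsto_abs_atBot_atTop.comp (tendsto_intCast_atBot_iff.2 tendsto_id)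
  refine (hpow.comp habs).congr' ?_
  filter_upwards [eventually_lt_atBot 0] with j hj
  rw [levelRadius_of_ne_zero hj.ne, radius, if_neg hj.not_gt, Function.comp_apply]

end LevelRadius

namespace AlphaCovering

variable {α : ℝ} {C : AlphaCovering α} {j : ℤ}

/-- An interval `I_{j,n}` of the covering, given by its level `j` and its index `n`. -/
structure Interval (C : AlphaCovering α) where
  level : ℤ
  index : ℤ
  isLevel : IsLevel level
  mem_Icc : index ∈ Set.Icc (-(C.N level : ℤ)) (C.N level)

namespace Interval

/-- The left endpoint of an interval of the covering. -/
def left (I : C.Interval) : ℝ := C.r I.level I.index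

/-- The right endpoint of an interval of the covering. -/
def right (I : C.Interval) : ℝ := C.r I.level (I.index + 1)

/-- The outermost intervals of a level, that is, the two components of `A_j \ A_{j-1}`. -/
def IsOuter (I : C.Interval) : Prop := I.index = -(C.N I.level : ℤ) ∨ I.index = C.N I.level

lemma admissible (I : C.Interval) : Admissible I.left I.right (C.ε I.left) (C.ε I.right) where
  left_pos := C.ε_pos I.level I.isLevel I.index
    ⟨I.mem_Icc.1, I.mem_Icc.2.trans (lt_add_one _).le⟩
  right_pos := C.ε_pos I.level I.isLevel (I.index + 1)
    ⟨I.mem_Icc.1.trans (lt_add_one _).le, by simpa using I.mem_Icc.2⟩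
  add_le := C.ε_add_le I.level I.isLevel I.index I.mem_Icc

end Interval

variable (C) in
/-- The outermost interval `[-R_j, -R_{j-1})` on the left. -/
def firstInterval (hj : IsLevel j) : C.Interval := ⟨j, -(C.N j : ℤ), hj, le_rfl, by lia⟩

variable (C) in
/-- The outermost interval `[R_{j-1}, R_j)` on the right. -/
def lastInterval (hj : IsLevel j) : C.Interval := ⟨j, C.N j, hj, by lia, le_rfl⟩

lemma left_firstInterval (hj : IsLevel j) : (C.firstInterval hj).left = -levelRadius α j :=
  (C.r_first j hj).trans (by rw [hj.levelRadius_eq])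

lemma right_firstInterval (hj : IsLevel j) :
    (C.firstInterval hj).right = -levelRadius α (j - 1) :=
  (C.r_second j hj).trans (by rw [hj.levelRadius_sub_one])

lemma left_lastInterval (hj : IsLevel j) : (C.lastInterval hj).left = levelRadius α (j - 1) :=
  (C.r_penultimate j hj).trans hj.levelRadius_sub_one.symm

lemma right_lastInterval (hj : IsLevel j) : (C.lastInterval hj).right = levelRadius α j :=
  (C.r_last j hj).trans hj.levelRadius_eq.symm

lemma Interval.IsOuter.eq_firstInterval_or_eq_lastInterval {I : C.Interval} (hI : I.IsOuter) :
    I = C.firstInterval I.isLevel ∨ I = C.lastInterval I.isLevel := by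
  obtain ⟨i, n, hi, hn⟩ := I
  obtain rfl | rfl : n = -(C.N i : ℤ) ∨ n = C.N i := hI
  exacts [.inl rfl, .inr rfl]

lemma mem_annulus_iff {q : ℤ × ℤ} : q ∈ C.annulus j ↔ IsLevel j ∧
    (q.1 ∈ Set.Icc (-(C.N j : ℤ)) (C.N j) ∧ q.2 ∈ Set.Icc (-(C.N j : ℤ)) (C.N j)) ∧
    ((q.1 = -(C.N j : ℤ) ∨ q.1 = C.N j) ∨ (q.2 = -(C.N j : ℤ) ∨ q.2 = C.N j)) := by
  simp only [annulus, annulusL, annulusR, annulusT, annulusB, Set.mem_union, Set.mem_ofPred_eq,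
    Set.mem_Icc]
  refine and_congr_right fun hj => ?_
  have := C.one_le_N j hj
  lia

/-- The first factor of a rectangle of the annulus. -/
def fstInterval (q : C.annulus j) : C.Interval :=
  have h := mem_annulus_iff.1 q.2
  ⟨j, q.1.1, h.1, h.2.1.1⟩

/-- The second factor of a rectangle of the annulus. -/
def sndInterval (q : C.annulus j) : C.Interval :=
  have h := mem_annulus_iff.1 q.2
  ⟨j, q.1.2, h.1, h.2.1.2⟩

lemma isOuter_fstInterval_or_sndInterval (q : C.annulus j) :
    (fstInterval q).IsOuter ∨ (sndInterval q).IsOuter :=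
  (mem_annulus_iff.1 q.2).2.2

section Bands

variable {𝕜 H : Type*} [RCLike 𝕜] [NormedAddCommGroup H] [InnerProductSpace 𝕜 H]
  {E : ℝ → Submodule 𝕜 H}

/-- The part of a filtration `E` that belongs to an interval of the covering. -/
def band (E : ℝ → Submodule 𝕜 H) (I : C.Interval) : Submodule 𝕜 H :=
  orthoDiff (E I.left) (E I.right)

/-- The part of a filtration `E` that belongs to `A_j`. -/
def levelBand (α : ℝ) (E : ℝ → Submodule 𝕜 H) (j : ℤ) : Submodule 𝕜 H :=
  orthoDiff (E (-levelRadius α j)) (E (levelRadius α j))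

instance [CompleteSpace H] [∀ t, CompleteSpace (E t)] (j : ℤ) :
    CompleteSpace (levelBand α E j) :=
  inferInstanceAs (CompleteSpace (orthoDiff _ _))

lemma levelBand_sub_one_of_not_isLevel (hj : ¬IsLevel j) :
    levelBand α E (j - 1) = levelBand α E j := by
  rw [levelBand, levelBand, levelRadius_sub_one_of_not_isLevel hj]

lemma Interval.IsOuter.isOrtho_band_levelBand {I : C.Interval} (hI : I.IsOuter) :
    band E I ⟂ levelBand α E (I.level - 1) := by
  rcases hI.eq_firstInterval_or_eq_lastInterval with h | h
  · rw [h, band, right_firstInterval]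
    exact isOrtho_orthoDiff le_rfl
  · rw [h, band, left_lastInterval]
    exact (isOrtho_orthoDiff le_rfl).symm

variable (hE : ∀ I : C.Interval, E I.right ≤ E I.left)
include hE

lemma apply_endpoint_le_of_le (hj : IsLevel j) {m n : ℤ} (hm : -(C.N j : ℤ) ≤ m) (hmn : m ≤ n)
    (hn : n ≤ C.N j + 1) : E (C.r j n) ≤ E (C.r j m) := by
  induction n, hmn using Int.leInduction with
  | base => exact le_rfl
  | succ n hmn ih => exact (hE ⟨j, n, hj, by lia, by lia⟩).trans (ih (by lia))

lemma apply_right_le_apply_left_of_index_lt {I J : C.Interval} (hlevel : I.level = J.level)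
    (hindex : I.index < J.index) : E J.left ≤ E I.right := by
  obtain ⟨i, m, hi, hm⟩ := I
  obtain ⟨j, n, hj, hn⟩ := J
  obtain rfl : i = j := hlevel
  exact apply_endpoint_le_of_le hE hi (by linarith [hm.1]) hindex (by linarith [hn.2])

lemma isOrtho_band_of_index_ne {I J : C.Interval} (hlevel : I.level = J.level)
    (hindex : I.index ≠ J.index) : band E I ⟂ band E J := by
  rcases lt_or_gt_of_ne hindex with h | h
  · exact isOrtho_orthoDiff (apply_right_le_apply_left_of_index_lt hE hlevel h)
  · exact (isOrtho_orthoDiff (apply_right_le_apply_left_of_index_lt hE hlevel.symm h)).symm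

lemma band_le_levelBand (I : C.Interval) : band E I ≤ levelBand α E I.level := by
  obtain ⟨j, n, hj, hn⟩ := I
  rw [levelBand, hj.levelRadius_eq, ← C.r_first j hj, ← C.r_last j hj]
  exact orthoDiff_mono (apply_endpoint_le_of_le hE hj le_rfl hn.1 (by linarith [hn.2]))
    (apply_endpoint_le_of_le hE hj (by linarith [hn.1]) (by linarith [hn.2]) le_rfl)

lemma apply_levelRadius_le (j : ℤ) : E (levelRadius α j) ≤ E (-levelRadius α j) := by
  have of_isLevel {j : ℤ} (hj : IsLevel j) : E (levelRadius α j) ≤ E (-levelRadius α j) := by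
    rw [hj.levelRadius_eq, ← C.r_first j hj, ← C.r_last j hj]
    exact apply_endpoint_le_of_le hE hj le_rfl (by lia) le_rfl
  by_cases hj : IsLevel j
  · exact of_isLevel hj
  · rw [levelRadius_of_not_isLevel hj, ← levelRadius_neg_one (α := α)]
    exact of_isLevel (.inl le_rfl)

lemma monotone_levelBand : Monotone (levelBand α E) := by
  refine monotone_int_of_le_succ fun i => ?_
  obtain ⟨j, rfl⟩ : ∃ j, i = j - 1 := ⟨i + 1, by ring⟩
  rw [sub_add_cancel]
  by_cases hj : IsLevel j
  · have hfirst := hE (C.firstInterval hj)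
    have hlast := hE (C.lastInterval hj)
    rw [left_firstInterval, right_firstInterval] at hfirst
    rw [left_lastInterval, right_lastInterval] at hlast
    exact orthoDiff_mono hfirst hlast
  · exact (levelBand_sub_one_of_not_isLevel hj).le

lemma isOrtho_band_of_level_lt {I J : C.Interval} (hJ : J.IsOuter) (h : I.level < J.level) :
    band E J ⟂ band E I :=
  hJ.isOrtho_band_levelBand.mono_right
    ((band_le_levelBand hE I).trans (monotone_levelBand hE (by lia)))

lemma isOrtho_band_fst_or_snd {p q : Σ j : ℤ, C.annulus j} (hpq : p ≠ q) :
    band E (fstInterval p.2) ⟂ band E (fstInterval q.2) ∨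
      band E (sndInterval p.2) ⟂ band E (sndInterval q.2) := by
  rcases lt_trichotomy p.1 q.1 with hlt | heq | hgt
  · exact (isOuter_fstInterval_or_sndInterval q.2).imp
      (fun h => (isOrtho_band_of_level_lt hE h hlt).symm)
      fun h => (isOrtho_band_of_level_lt hE h hlt).symm
  · obtain ⟨i, ⟨m, hm⟩⟩ := p
    obtain ⟨j, ⟨n, hn⟩⟩ := q
    obtain rfl : i = j := heq
    have hmn : m.1 ≠ n.1 ∨ m.2 ≠ n.2 := by
      contrapose! hpq
      simp only [Prod.ext hpq.1 hpq.2]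
    exact hmn.imp (isOrtho_band_of_index_ne hE rfl) (isOrtho_band_of_index_ne hE rfl)
  · exact (isOuter_fstInterval_or_sndInterval p.2).imp
      (fun h => isOrtho_band_of_level_lt hE h hgt) fun h => isOrtho_band_of_level_lt hE h hgt

variable {ι K : Type*} [NormedAddCommGroup K] [InnerProductSpace 𝕜 K] {T : H →L[𝕜] H →L[𝕜] K}
  (b : ∀ I : C.Interval, HilbertBasis ι 𝕜 (band E I))

/-- The tensor products of basis elements that belong to the sides of a rectangle of the annuli. -/
def tensorSystem (T : H →L[𝕜] H →L[𝕜] K) (b : ∀ I : C.Interval, HilbertBasis ι 𝕜 (band E I))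
    (p : (Σ j : ℤ, C.annulus j) × (ι × ι)) : K :=
  T (b (fstInterval p.1.2) p.2.1) (b (sndInterval p.1.2) p.2.2)

lemma orthonormal_tensorSystem (hT : IsHilbertTensor T) : Orthonormal 𝕜 (tensorSystem T b) := by
  have hnorm (I : C.Interval) (k : ι) : ‖(b I k : H)‖ = 1 := (b I).orthonormal.1 k
  have hinner (I : C.Interval) {k l : ι} (hkl : k ≠ l) : ⟪(b I k : H), b I l⟫_𝕜 = 0 :=
    (b I).orthonormal.2 hkl
  refine hT.orthonormal (fun p => hnorm _ _) (fun p => hnorm _ _) ?_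
  rintro ⟨p, k⟩ ⟨q, l⟩ hne
  by_cases hpq : p = q
  · subst hpq
    have hkl : k.1 ≠ l.1 ∨ k.2 ≠ l.2 := by
      contrapose! hne
      rw [Prod.ext hne.1 hne.2]
    exact hkl.imp (hinner _) (hinner _)
  · exact (isOrtho_band_fst_or_snd hE hpq).imp
      (fun h => Submodule.isOrtho_iff_inner_eq.1 h _ (b _ _).2 _ (b _ _).2)
      fun h => Submodule.isOrtho_iff_inner_eq.1 h _ (b _ _).2 _ (b _ _).2

variable [CompleteSpace H] [∀ t, CompleteSpace (E t)]

lemma starProjection_levelBand_eq_sum (hj : IsLevel j) (f : H) :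
    (levelBand α E j).starProjection f = ∑ n ∈ Finset.Ico (-(C.N j : ℤ)) (C.N j + 1),
      (orthoDiff (E (C.r j n)) (E (C.r j (n + 1)))).starProjection f := by
  rw [sum_starProjection_orthoDiff (U := fun n => E (C.r j n)) (by lia)
    fun n hn => hE ⟨j, n, hj, by grind⟩, C.r_first j hj, C.r_last j hj, ← hj.levelRadius_eq]
  exact starProjection_orthoDiff (apply_levelRadius_le hE j) f

lemma starProjection_levelBand_sub_one_eq_sum (hj : IsLevel j) (f : H) :
    (levelBand α E (j - 1)).starProjection f = ∑ n ∈ Finset.Ico (-(C.N j : ℤ) + 1) (C.N j),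
      (orthoDiff (E (C.r j n)) (E (C.r j (n + 1)))).starProjection f := by
  have hN := C.one_le_N j hj
  rw [sum_starProjection_orthoDiff (U := fun n => E (C.r j n)) (by lia)
    fun n hn => hE ⟨j, n, hj, by grind⟩, C.r_second j hj, C.r_penultimate j hj,
    ← hj.levelRadius_sub_one]
  exact starProjection_orthoDiff (apply_levelRadius_le hE (j - 1)) f

variable {h : K} (hh : ∀ p, ⟪h, tensorSystem T b p⟫_𝕜 = 0) (f g : H)
include hh

lemma inner_levelBand_sub_one (j : ℤ) :
    ⟪h, T ((levelBand α E j).starProjection f) ((levelBand α E j).starProjection g)⟫_𝕜 =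
      ⟪h, T ((levelBand α E (j - 1)).starProjection f)
        ((levelBand α E (j - 1)).starProjection g)⟫_𝕜 := by
  by_cases hj : IsLevel j
  · simp only [starProjection_levelBand_eq_sum hE hj,
      starProjection_levelBand_sub_one_eq_sum hE hj]
    refine inner_apply_sum_sum_of_subset T (Finset.Ico_subset_Ico (by lia) (by lia))
      fun q hq hq' => ?_
    have hannulus : q ∈ C.annulus j := by
      simp only [Finset.mem_product, Finset.mem_Ico] at hq hq'
      simp only [mem_annulus_iff, Set.mem_Icc, hj, true_and]
      lia
    exact inner_apply_eq_zero_of_hilbertBasis T (b (fstInterval ⟨q, hannulus⟩))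
      (b (sndInterval ⟨q, hannulus⟩)) (fun k l => hh (⟨j, q, hannulus⟩, k, l))
      ((orthoDiff _ _).starProjection_apply_mem f) ((orthoDiff _ _).starProjection_apply_mem g)
  · simp only [levelBand_sub_one_of_not_isLevel hj]

lemma inner_levelBand_eq (i j : ℤ) :
    ⟪h, T ((levelBand α E i).starProjection f) ((levelBand α E i).starProjection g)⟫_𝕜 =
      ⟪h, T ((levelBand α E j).starProjection f) ((levelBand α E j).starProjection g)⟫_𝕜 := by
  wlog hij : i ≤ j generalizing i j
  · exact (this j i (le_of_not_ge hij)).symm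
  induction j, hij using Int.leInduction with
  | base => rfl
  | succ j _ ih => rw [ih, inner_levelBand_sub_one hE b hh f g (j + 1), add_sub_cancel_right]

lemma inner_apply_eq_zero_of_levelBand (htop : ⨅ j, (levelBand α E j)ᗮ = ⊥)
    (hbot : ⨅ j, levelBand α E j = ⊥) : ⟪h, T f g⟫_𝕜 = 0 := by
  have hmono := monotone_levelBand hE
  have hcont : Continuous fun p : H × H => ⟪h, T p.1 p.2⟫_𝕜 := by fun_prop
  have hlim_top := (hcont.tendsto _).comp
    ((tendsto_starProjection_atTop hmono htop f).prodMk_nhds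
      (tendsto_starProjection_atTop hmono htop g))
  have hlim_bot := (hcont.tendsto _).comp
    ((tendsto_starProjection_atBot hmono hbot f).prodMk_nhds
      (tendsto_starProjection_atBot hmono hbot g))
  have hconst (l : Filter ℤ) := tendsto_const_nhds (f := l).congr fun j =>
    inner_levelBand_eq hE b hh f g 0 j
  rw [tendsto_nhds_unique hlim_top (hconst atTop), tendsto_nhds_unique (hconst atBot) hlim_bot]
  simp

omit hh

/-- The Hilbert basis of a tensor product that belongs to the rectangles of the annuli. -/
def tensorBasis [CompleteSpace K] (hT : IsHilbertTensor T) (htop : ⨅ j, (levelBand α E j)ᗮ = ⊥)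
    (hbot : ⨅ j, levelBand α E j = ⊥) : HilbertBasis ((Σ j : ℤ, C.annulus j) × (ι × ι)) 𝕜 K :=
  HilbertBasis.mkOfOrthogonalEqBot (orthonormal_tensorSystem hE b hT) <| by
    refine (Submodule.eq_bot_iff _).2 fun h hh => hT.eq_zero h fun f g => inner_eq_zero_symm.1 ?_
    exact inner_apply_eq_zero_of_levelBand hE b
      (fun p => (Submodule.mem_orthogonal' _ _).1 hh _ (Submodule.subset_span ⟨p, rfl⟩)) f g
      htop hbot

lemma coe_tensorBasis [CompleteSpace K] (hT : IsHilbertTensor T)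
    (htop : ⨅ j, (levelBand α E j)ᗮ = ⊥) (hbot : ⨅ j, levelBand α E j = ⊥) :
    ⇑(tensorBasis hE b hT htop hbot) = tensorSystem T b :=
  HilbertBasis.coe_mkOfOrthogonalEqBot _ _

end Bands

end AlphaCovering

namespace AlphaCovering

variable {α : ℝ} {j : ℤ} {ρ : ℝ → ℝ} (C : AlphaCovering α)

/-- The functions that live smoothly on the half line with endpoint `t`, for the frequency variable
`ξ / 2π` of Mathlib's Fourier transform. -/
def frequencyHalfLine (ρ : ℝ → ℝ) (t : ℝ) : Submodule ℂ (Lp ℂ 2 (volume : Measure ℝ)) :=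
  halfLine ρ (t / (2 * Real.pi)) (C.ε t / (2 * Real.pi))

instance (t : ℝ) : CompleteSpace (C.frequencyHalfLine ρ t) :=
  inferInstanceAs (CompleteSpace (halfLine _ _ _))

variable {C} (hρ : IsRamp ρ)

lemma Interval.admissible_div_two_pi (I : C.Interval) : Admissible (I.left / (2 * Real.pi))
    (I.right / (2 * Real.pi)) (C.ε I.left / (2 * Real.pi)) (C.ε I.right / (2 * Real.pi)) :=
  I.admissible.div_const Real.two_pi_pos

/-- The local cosine basis of an interval of the covering, for the frequency variable `ξ / 2π`. -/
def bandBasis (I : C.Interval) : HilbertBasis ℕ ℂ (band (C.frequencyHalfLine ρ) I) :=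
  I.admissible_div_two_pi.localCosineBasis hρ

lemma coe_bandBasis (I : C.Interval) (k : ℕ) :
    (bandBasis hρ I k : Lp ℂ 2 (volume : Measure ℝ)) =
      I.admissible_div_two_pi.localCosine hρ k :=
  I.admissible_div_two_pi.coe_localCosineBasis hρ k

lemma coeFn_fourierInv_bandBasis (I : C.Interval) (k : ℕ) :
    ⇑((Lp.fourierTransformₗᵢ ℝ ℂ).symm (bandBasis hρ I k : Lp ℂ 2 (volume : Measure ℝ)))
      =ᵐ[volume] brushlet ρ I.left I.right (C.ε I.left) (C.ε I.right) k := by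
  rw [coe_bandBasis]
  exact coeFn_fourierInv_localCosine hρ I.admissible k

include hρ

lemma frequencyHalfLine_right_le_left (I : C.Interval) :
    C.frequencyHalfLine ρ I.right ≤ C.frequencyHalfLine ρ I.left := by
  have hI := I.admissible_div_two_pi
  exact hρ.halfLine_le hI.left_pos hI.right_pos (by linarith [hI.add_le])

lemma ae_eq_zero_of_mem_frequencyHalfLine_right (I : C.Interval)
    {f : Lp ℂ 2 (volume : Measure ℝ)} (hf : f ∈ C.frequencyHalfLine ρ I.right) :
    ∀ᵐ ξ, ξ ≤ I.left / (2 * Real.pi) → f ξ = 0 := by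
  have hI := I.admissible_div_two_pi
  filter_upwards [hρ.ae_eq_zero_of_mem_halfLine hI.right_pos hf] with ξ hzero hξ
  exact hzero (by linarith [hI.add_le, hI.left_pos])

lemma ae_eq_zero_of_mem_orthogonal_frequencyHalfLine_left (I : C.Interval)
    {f : Lp ℂ 2 (volume : Measure ℝ)} (hf : f ∈ (C.frequencyHalfLine ρ I.left)ᗮ) :
    ∀ᵐ ξ, I.right / (2 * Real.pi) ≤ ξ → f ξ = 0 := by
  have hI := I.admissible_div_two_pi
  filter_upwards [hρ.ae_eq_zero_of_mem_orthogonal_halfLine hI.left_pos hf] with ξ hzero hξ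
  exact hzero (by linarith [hI.add_le, hI.right_pos])

lemma ae_eq_zero_of_mem_levelBand_sub_one (hj : IsLevel j) {f : Lp ℂ 2 (volume : Measure ℝ)}
    (hf : f ∈ levelBand α (C.frequencyHalfLine ρ) (j - 1)) :
    ∀ᵐ ξ, levelRadius α j / (2 * Real.pi) ≤ |ξ| → f ξ = 0 := by
  obtain ⟨hneg, hpos⟩ := mem_orthoDiff.1 hf
  rw [← right_firstInterval (C := C) hj] at hneg
  rw [← left_lastInterval (C := C) hj] at hpos
  filter_upwards [ae_eq_zero_of_mem_frequencyHalfLine_right hρ _ hneg,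
    ae_eq_zero_of_mem_orthogonal_frequencyHalfLine_left hρ _ hpos] with ξ hzero_neg hzero_pos hξ
  rw [left_firstInterval, neg_div] at hzero_neg
  rw [right_lastInterval] at hzero_pos
  exact (le_abs'.1 hξ).elim hzero_neg hzero_pos

lemma ae_eq_zero_of_mem_orthogonal_levelBand (hj : IsLevel j) {f : Lp ℂ 2 (volume : Measure ℝ)}
    (hf : f ∈ (levelBand α (C.frequencyHalfLine ρ) j)ᗮ) :
    ∀ᵐ ξ, |ξ| ≤ levelRadius α (j - 1) / (2 * Real.pi) → f ξ = 0 := by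
  have hle := apply_levelRadius_le (frequencyHalfLine_right_le_left hρ (C := C)) j
  obtain ⟨g, hg, g', hg', rfl⟩ := Submodule.mem_sup.1 (orthogonal_orthoDiff_le hle hf)
  rw [← left_firstInterval (C := C) hj] at hg
  rw [← right_lastInterval (C := C) hj] at hg'
  filter_upwards [ae_eq_zero_of_mem_orthogonal_frequencyHalfLine_left hρ _ hg,
    ae_eq_zero_of_mem_frequencyHalfLine_right hρ _ hg', Lp.coeFn_add g g']
    with ξ hzero hzero' hadd hξ
  rw [right_firstInterval, neg_div] at hzero
  rw [left_lastInterval] at hzero'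
  rw [hadd, Pi.add_apply, hzero (neg_le_of_abs_le hξ), hzero' (le_of_abs_le hξ), add_zero]

lemma iInf_orthogonal_levelBand (hα : α < 1) :
    ⨅ j, (levelBand α (C.frequencyHalfLine ρ) j)ᗮ = ⊥ := by
  refine (Submodule.eq_bot_iff _).2 fun f hf => (Lp.eq_zero_iff_ae_eq_zero).2 ?_
  have hzero : ∀ᵐ ξ, ∀ j, IsLevel (j + 1) →
      |ξ| ≤ levelRadius α j / (2 * Real.pi) → f ξ = 0 := by
    refine ae_all_iff.2 fun j => ?_
    by_cases hj : IsLevel (j + 1)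
    · simpa only [hj, true_imp_iff, add_sub_cancel_right] using
        ae_eq_zero_of_mem_orthogonal_levelBand hρ hj (Submodule.mem_iInf _ |>.1 hf (j + 1))
    · exact .of_forall fun ξ h => (hj h).elim
  filter_upwards [hzero] with ξ hξ
  obtain ⟨j, hj, hle⟩ := ((eventually_ge_atTop 1).and
    ((tendsto_levelRadius_atTop hα).eventually_ge_atTop (|ξ| * (2 * Real.pi)))).exists
  exact hξ j (.inr (by lia)) ((le_div_iff₀ Real.two_pi_pos).2 hle)

lemma iInf_levelBand (hα : α < 1) : ⨅ j, levelBand α (C.frequencyHalfLine ρ) j = ⊥ := by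
  refine (Submodule.eq_bot_iff _).2 fun f hf => (Lp.eq_zero_iff_ae_eq_zero).2 ?_
  have hzero : ∀ᵐ ξ, ∀ j, IsLevel j → levelRadius α j / (2 * Real.pi) ≤ |ξ| → f ξ = 0 := by
    refine ae_all_iff.2 fun j => ?_
    by_cases hj : IsLevel j
    · simpa only [hj, true_imp_iff] using
        ae_eq_zero_of_mem_levelBand_sub_one hρ hj (Submodule.mem_iInf _ |>.1 hf (j - 1))
    · exact .of_forall fun ξ h => (hj h).elim
  filter_upwards [hzero, volume.ae_ne 0] with ξ hξ hne
  obtain ⟨j, hj, hle⟩ := ((eventually_le_atBot (-1)).and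
    ((tendsto_levelRadius_atBot hα).eventually_le_const
      (mul_pos (abs_pos.2 hne) Real.two_pi_pos))).exists
  exact hξ j (.inl hj) ((div_le_iff₀ Real.two_pi_pos).2 hle)

end AlphaCovering

/-- The Hilbert tensor product `L²(ℝ) × L²(ℝ) → L²(ℝ²)` that takes the tensor product of the
inverse Fourier transforms of its arguments. -/
def fourierInvTensor : Lp ℂ 2 (volume : Measure ℝ) →L[ℂ] Lp ℂ 2 (volume : Measure ℝ) →L[ℂ]
    Lp ℂ 2 (volume : Measure (ℝ × ℝ)) :=
  (tensorCLM ℂ volume volume).bilinearComp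
    ((Lp.fourierTransformₗᵢ ℝ ℂ).symm : Lp ℂ 2 (volume : Measure ℝ) →L[ℂ] _)
    ((Lp.fourierTransformₗᵢ ℝ ℂ).symm : Lp ℂ 2 (volume : Measure ℝ) →L[ℂ] _)

lemma isHilbertTensor_fourierInvTensor : IsHilbertTensor fourierInvTensor :=
  (isHilbertTensor_tensorCLM ℂ volume volume).bilinearComp_linearIsometryEquiv _ _

namespace AlphaCovering

variable {α : ℝ} {ρ : ℝ → ℝ} {C : AlphaCovering α}

lemma coeFn_tensorSystem_bandBasis (hρ : IsRamp ρ) (j : ℤ) (q : C.annulus j) (k : ℕ × ℕ) :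
    ⇑(tensorSystem fourierInvTensor (bandBasis hρ) (⟨j, q⟩, k)) =ᵐ[volume] C.bivariate ρ j q k :=
  tensorLp_congr (coeFn_fourierInv_bandBasis hρ (fstInterval q) k.1)
    (coeFn_fourierInv_bandBasis hρ (sndInterval q) k.2)

end AlphaCovering

end Brushlet

end

open Brushlet AlphaCovering in
theorem mainTheorem2_general (α : ℝ) (hα : α < 1) (ρ : ℝ → ℝ) (hρ : IsRamp ρ)
    (C : AlphaCovering α) :
    ∃ w : HilbertBasis ((Σ j : ℤ, C.annulus j) × (ℕ × ℕ)) ℂ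
        (Lp ℂ 2 (volume : Measure (ℝ × ℝ))),
      ∀ (j : ℤ) (q : C.annulus j) (k : ℕ × ℕ),
        ⇑(w (⟨j, q⟩, k)) =ᵐ[volume] C.bivariate ρ j q k := by
  have hnested := frequencyHalfLine_right_le_left hρ (C := C)
  have htop := iInf_orthogonal_levelBand hρ hα (C := C)
  have hbot := iInf_levelBand hρ hα (C := C)
  refine ⟨tensorBasis hnested (bandBasis hρ) isHilbertTensor_fourierInvTensor htop hbot,
    fun j q k => ?_⟩
  rw [coe_tensorBasis]
  exact coeFn_tensorSystem_bandBasis hρ j q k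

theorem mainTheorem2 (α : ℝ) (hα₀ : 0 ≤ α) (hα₁ : α < 1)
    (ρ : ℝ → ℝ) (hρ : Brushlet.IsRamp ρ) (C : Brushlet.AlphaCovering α) :
    ∃ w : HilbertBasis ((Σ j : ℤ, C.annulus j) × (ℕ × ℕ)) ℂ
        (MeasureTheory.Lp ℂ 2 (MeasureTheory.volume : MeasureTheory.Measure (ℝ × ℝ))),
      ∀ (j : ℤ) (q : C.annulus j) (k : ℕ × ℕ),
        ⇑(w (⟨j, q⟩, k)) =ᵐ[MeasureTheory.volume] C.bivariate ρ j q k :=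
  mainTheorem2_general α hα₁ ρ hρ C
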